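/- Let $f \colon \widehat{\mathbb{C}} \to \widehat{\mathbb{C}}$ be a rational map of degree $2$ of the Riemann sphere. A point $z_0 \in \widehat{\mathbb{C}}$ is periodic for $f$ if $f^{\circ n}(z_0) = z_0$ for some $n \geq 1$; the least such $n$ is its period, and the multiplier of $f$ at $z_0$ is then the unique eigenvalue of the differential of $f^{\circ n}$ at $z_0$. Assume that the multiplier of $f$ at every periodic point is an integer (an element of $\mathbb{Z}$). Then $f$ is a power map or a Chebyshev map. Here a rational map of degree $d \geq 2$ is called a power map if it is conjugate, by a Möbius transformation, to $z \mapsto z^{d}$ or $z \mapsto z^{-d}$, and a Chebyshev map if it is conjugate, by a Möbius transformation, to $T_d$ or $-T_d$, where $T_d \in \mathbb{C}[z]$ is the unique polynomial such that $T_d(z + z^{-1}) = z^{d} + z^{-d}$. -/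

import Mathlib

open Polynomial OnePoint
open scoped MatrixGroups

noncomputable section

/-- The map `z ↦ p(z) / q(z)` of the Riemann sphere `OnePoint ℂ = ℂ ∪ {∞}` to itself,
for coprime `p` and `q`. With `d = max (deg p) (deg q)`, its value at `∞` is the quotient of the
coefficients of degree `d` (and `∞` if that of `q` vanishes). -/
def ratMap (p q : ℂ[X]) : OnePoint ℂ → OnePoint ℂ := fun x =>
  x.elim
    (if q.coeff (max p.natDegree q.natDegree) = 0 then ∞
      else ((p.coeff (max p.natDegree q.natDegree) /
        q.coeff (max p.natDegree q.natDegree) : ℂ) : OnePoint ℂ))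
    (fun z => if q.eval z = 0 then ∞ else ((p.eval z / q.eval z : ℂ) : OnePoint ℂ))

/-- `f` is a rational map of degree `d` of the Riemann sphere. -/
def IsRationalMap (d : ℕ) (f : OnePoint ℂ → OnePoint ℂ) : Prop :=
  ∃ p q : ℂ[X], IsCoprime p q ∧ max p.natDegree q.natDegree = d ∧ f = ratMap p q

/-- The involution `z ↦ 1 / z` of the Riemann sphere, exchanging `0` and `∞`. -/
def sphereInv : OnePoint ℂ → OnePoint ℂ := fun x =>
  x.elim ((0 : ℂ) : OnePoint ℂ) (fun z => if z = 0 then ∞ else ((z⁻¹ : ℂ) : OnePoint ℂ))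

/-- The affine coordinate on the finite part of the sphere (with an arbitrary value at `∞`). -/
def affineCoord : OnePoint ℂ → ℂ := fun x => x.elim 0 id

/-- The differential of `g` at its fixed point `x` is multiplication by `μ`. It is computed in the
chart `z` if `x` is finite, and in the chart `1 / z` if `x = ∞`. -/
def HasFixedPointMultiplier (g : OnePoint ℂ → OnePoint ℂ) (x : OnePoint ℂ) (μ : ℂ) : Prop :=
  x.elim
    (HasDerivAt (fun w : ℂ => affineCoord (sphereInv (g (sphereInv (w : OnePoint ℂ))))) μ 0)
    (fun z => HasDerivAt (fun w : ℂ => affineCoord (g (w : OnePoint ℂ))) μ z)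

/-- `μ` is the multiplier of `f` at the periodic point `x`: with `n` the (least) period of `x`,
it is the eigenvalue of the differential of the `n`th iterate of `f` at `x`. -/
def HasMultiplierAt (f : OnePoint ℂ → OnePoint ℂ) (x : OnePoint ℂ) (μ : ℂ) : Prop :=
  x ∈ Function.periodicPts f ∧ HasFixedPointMultiplier (f^[Function.minimalPeriod f x]) x μ

/-- The multipliers of `f` at all of its cycles are integers. -/
def HasOnlyIntegerMultipliers (f : OnePoint ℂ → OnePoint ℂ) : Prop :=
  ∀ (x : OnePoint ℂ) (μ : ℂ), HasMultiplierAt f x μ → ∃ m : ℤ, μ = (m : ℂ)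

/-- `f` and `g` are conjugate by a Möbius transformation. -/
def AreMoebiusConjugate (f g : OnePoint ℂ → OnePoint ℂ) : Prop :=
  ∃ φ : GL (Fin 2) ℂ, ∀ x : OnePoint ℂ, φ • f x = g (φ • x)

/-- Power maps: rational maps of some degree `d ≥ 2` conjugate to `z ↦ z ^ d` or `z ↦ z ^ (-d)`. -/
def IsPowerMap (f : OnePoint ℂ → OnePoint ℂ) : Prop :=
  ∃ d : ℕ, 2 ≤ d ∧ IsRationalMap d f ∧
    (AreMoebiusConjugate f (ratMap (X ^ d) 1) ∨ AreMoebiusConjugate f (ratMap 1 (X ^ d)))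

/-- Chebyshev maps: rational maps of some degree `d ≥ 2` conjugate to `T_d` or `-T_d`, where `T_d`
is the monic Chebyshev polynomial, which is `Polynomial.Chebyshev.C ℂ d` in Mathlib. -/
def IsChebyshevMap (f : OnePoint ℂ → OnePoint ℂ) : Prop :=
  ∃ d : ℕ, 2 ≤ d ∧ IsRationalMap d f ∧
    (AreMoebiusConjugate f (ratMap (Chebyshev.C ℂ d) 1) ∨
      AreMoebiusConjugate f (ratMap (-Chebyshev.C ℂ d) 1))

/-- The defining property `T_d (z + 1 / z) = z ^ d + 1 / z ^ d` of the polynomials used above. -/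
theorem chebyshevC_eval_add_inv (d : ℕ) (z : ℂ) (hz : z ≠ 0) :
    (Chebyshev.C ℂ d).eval (z + z⁻¹) = z ^ d + z⁻¹ ^ d := by
  rw [← dickson_one_one_eq_chebyshev_C]
  exact dickson_one_one_eval_add_inv z z⁻¹ (mul_inv_cancel₀ hz) d

end

/-! A quadratic map has three fixed points with multiplicity. If no multiplier `μ` is 1, the three
numbers `1 - μ`, say `A`, `B`, `C`, satisfy `1/A + 1/B + 1/C = 1` (the fixed point formula, with
denominators cleared in `exists_three_multipliers`). For integers this leaves finitely many maps
unless some `μ` is 0 or 1; in those cases a one-parameter family remains and 3-cycles cut it down.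

Multiplier 0: the map is `z² + c` with `4c = 1 - n²`, where `1 - n` is a fixed point multiplier. The
two 3-cycle multipliers involve `√(n² - 8)`, so `c = 0` or `n² - 8` is a square, which forces `c =
-2` (`poly_sq_of_integerCycleMultipliers`).

Multiplier 1: the map is `w - 1/w` or `w + 1 + k/w` with `a = 1/k` an integer. Now `a² - 3a` must be
a square, so `a` is -1, 3 or 4 (`laurent_eq_of_integerCycleMultipliers`).

Otherwise `{A, B, C}` is `{3, 3, 3}`, which gives `1/z²`, or `{2, 3, 6}` or `{2, 4, 4}`.

The four maps left with multiplier 1 and the two with multiplier -1 are excluded by a real 5-cycle: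
the intermediate value theorem produces it near an approximate orbit, and error bounds place its
multiplier strictly between consecutive integers (`not_integerCycleMultipliers_laurent`). -/

/-! ### Homogeneous coordinates on the sphere -/

open Classical in
/-- The point of the sphere with homogeneous coordinates `[x : y]`. -/
noncomputable def homPt (x y : ℂ) : OnePoint ℂ := if y = 0 then ∞ else ((x / y : ℂ) : OnePoint ℂ)

lemma homPt_zero_right (x : ℂ) : homPt x 0 = ∞ := by simp [homPt]

lemma homPt_of_ne {x y : ℂ} (hy : y ≠ 0) : homPt x y = ((x / y : ℂ) : OnePoint ℂ) := by
  simp [homPt, hy]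

lemma homPt_one_right (z : ℂ) : homPt z 1 = (z : OnePoint ℂ) := by simp [homPt]

lemma homPt_mul {k : ℂ} (hk : k ≠ 0) (x y : ℂ) : homPt (k * x) (k * y) = homPt x y := by
  by_cases hy : y = 0
  · simp [hy, homPt_zero_right]
  · rw [homPt_of_ne hy, homPt_of_ne (mul_ne_zero hk hy), mul_div_mul_left _ _ hk]

lemma sphereInv_coe (w : ℂ) : sphereInv (w : OnePoint ℂ) = homPt 1 w := by
  by_cases hw : w = 0
  · simp [hw, sphereInv, homPt]
  · simp [hw, sphereInv, homPt]

lemma sphereInv_sphereInv (x : OnePoint ℂ) : sphereInv (sphereInv x) = x := by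
  induction x using OnePoint.rec with
  | infty => simp [sphereInv]
  | coe z =>
    by_cases hz : z = 0
    · simp [hz, sphereInv]
    · simp [hz, sphereInv]

lemma exists_homPt (x : OnePoint ℂ) : ∃ a b : ℂ, (a ≠ 0 ∨ b ≠ 0) ∧ x = homPt a b := by
  induction x using OnePoint.rec with
  | infty => exact ⟨1, 0, by simp, by simp [homPt]⟩
  | coe z => exact ⟨z, 1, by simp, (homPt_one_right z).symm⟩

lemma smul_homPt (g : GL (Fin 2) ℂ) {x y : ℂ} (h : x ≠ 0 ∨ y ≠ 0) :
    g • homPt x y = homPt (g 0 0 * x + g 0 1 * y) (g 1 0 * x + g 1 1 * y) := by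
  by_cases hy : y = 0
  · subst hy
    have hx : x ≠ 0 := by simpa using h
    rw [homPt_zero_right, OnePoint.smul_infty_eq_ite, mul_zero, mul_zero, add_zero, add_zero,
      mul_comm _ x, mul_comm _ x, homPt_mul hx]
    simp only [homPt]
  · rw [homPt_of_ne hy, OnePoint.smul_some_eq_ite]
    have h1 : g 0 0 * x + g 0 1 * y = y * (g 0 0 * (x / y) + g 0 1) := by field_simp
    have h2 : g 1 0 * x + g 1 1 * y = y * (g 1 0 * (x / y) + g 1 1) := by field_simp
    rw [h1, h2, homPt_mul hy]
    simp only [homPt]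

/-! ### Derivatives of self-maps of the sphere -/

/-- The inverse of the standard chart around `x`. -/
noncomputable def chartInv (x : OnePoint ℂ) (w : ℂ) : OnePoint ℂ :=
  x.elim (sphereInv (w : OnePoint ℂ)) (fun _ => (w : OnePoint ℂ))

lemma chartInv_infty (w : ℂ) : chartInv ∞ w = sphereInv (w : OnePoint ℂ) := rfl

lemma chartInv_coe (z w : ℂ) : chartInv (z : OnePoint ℂ) w = (w : OnePoint ℂ) := rfl

lemma affineCoord_infty : affineCoord ∞ = 0 := rfl

lemma affineCoord_coe (z : ℂ) : affineCoord (z : OnePoint ℂ) = z := rfl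

/-- The default value 0 of `affineCoord` at `∞` is also the coordinate of `∞` in the chart `1 / z`,
so no case distinction is needed. -/
lemma chartInv_affineCoord (x : OnePoint ℂ) : chartInv x (affineCoord x) = x := by
  induction x using OnePoint.rec with
  | infty => simp [chartInv_infty, affineCoord_infty, sphereInv_coe, homPt_zero_right]
  | coe z => rfl

lemma chartInv_injective (x : OnePoint ℂ) : Function.Injective (chartInv x) := by
  intro v w h
  induction x using OnePoint.rec with
  | infty =>
    simp only [chartInv_infty] at h
    have := congrArg sphereInv h
    rw [sphereInv_sphereInv, sphereInv_sphereInv] at this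
    exact OnePoint.coe_injective this
  | coe z => exact OnePoint.coe_injective h

/-- In the standard charts around `x` and `G x`, the map `G` is given near `x` by a function with
derivative `m`. -/
def HasSphereDeriv (G : OnePoint ℂ → OnePoint ℂ) (x : OnePoint ℂ) (m : ℂ) : Prop :=
  ∃ h : ℂ → ℂ, HasDerivAt h m (affineCoord x) ∧
    ∀ᶠ w in nhds (affineCoord x), G (chartInv x w) = chartInv (G x) (h w)

namespace HasSphereDeriv

variable {G H : OnePoint ℂ → OnePoint ℂ} {x : OnePoint ℂ} {m n : ℂ}

lemma apply_affineCoord {h : ℂ → ℂ}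
    (hh : ∀ᶠ w in nhds (affineCoord x), G (chartInv x w) = chartInv (G x) (h w)) :
    h (affineCoord x) = affineCoord (G x) := by
  have := hh.self_of_nhds
  rw [chartInv_affineCoord] at this
  apply chartInv_injective (G x)
  rw [chartInv_affineCoord, ← this]

lemma unique (h₁ : HasSphereDeriv G x m) (h₂ : HasSphereDeriv G x n) : m = n := by
  obtain ⟨a, ha, ha'⟩ := h₁
  obtain ⟨b, hb, hb'⟩ := h₂
  refine ha.unique (hb.congr_of_eventuallyEq ?_)
  filter_upwards [ha', hb'] with w h1 h2
  exact chartInv_injective _ (h1.symm.trans h2)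

lemma comp (hH : HasSphereDeriv H (G x) n) (hG : HasSphereDeriv G x m) :
    HasSphereDeriv (H ∘ G) x (n * m) := by
  obtain ⟨a, ha, ha'⟩ := hG
  obtain ⟨b, hb, hb'⟩ := hH
  have hax := apply_affineCoord ha'
  refine ⟨b ∘ a, (hax ▸ hb).comp _ ha, ?_⟩
  have hb'' : ∀ᶠ w in nhds (affineCoord x), H (chartInv (G x) (a w)) =
      chartInv (H (G x)) (b (a w)) := by
    have := ha.continuousAt.tendsto
    rw [hax] at this
    exact this.eventually hb'
  filter_upwards [ha', hb''] with w h1 h2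
  simp [h1, h2]

protected lemma id : HasSphereDeriv id x 1 :=
  ⟨id, hasDerivAt_id _, by simp⟩

/-- Passes from the derivative that obeys the chain rule to the multiplier of the theorem. This
direction suffices: multipliers are exhibited, and the hypothesis then makes them integers. -/
lemma hasFixedPointMultiplier (h : HasSphereDeriv G x m) (hx : G x = x) :
    HasFixedPointMultiplier G x m := by
  obtain ⟨a, ha, ha'⟩ := h
  rw [hx] at ha'
  induction x using OnePoint.rec with
  | infty =>
    refine HasDerivAt.congr_of_eventuallyEq ha ?_
    filter_upwards [ha'] with w hw
    rw [chartInv_infty, chartInv_infty] at hw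
    rw [hw, sphereInv_sphereInv, affineCoord_coe]
  | coe z =>
    refine HasDerivAt.congr_of_eventuallyEq ha ?_
    filter_upwards [ha'] with w hw
    rw [chartInv_coe, chartInv_coe] at hw
    rw [hw, affineCoord_coe]

lemma of_homPt_finite {P Q : ℂ → ℂ} (hG : ∀ w, G (chartInv x w) = homPt (P w) (Q w))
    (hQ : Q (affineCoord x) ≠ 0) (hQc : ContinuousAt Q (affineCoord x))
    (hd : HasDerivAt (fun w => P w / Q w) m (affineCoord x)) : HasSphereDeriv G x m := by
  refine ⟨_, hd, ?_⟩
  have hx := hG (affineCoord x)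
  rw [chartInv_affineCoord, homPt_of_ne hQ] at hx
  filter_upwards [hQc.eventually_ne hQ] with w hw
  rw [hG, hx, chartInv_coe, homPt_of_ne hw]

lemma of_homPt_infty {P Q : ℂ → ℂ} (hG : ∀ w, G (chartInv x w) = homPt (P w) (Q w))
    (hQ : Q (affineCoord x) = 0) (hP : P (affineCoord x) ≠ 0)
    (hPc : ContinuousAt P (affineCoord x))
    (hd : HasDerivAt (fun w => Q w / P w) m (affineCoord x)) : HasSphereDeriv G x m := by
  refine ⟨_, hd, ?_⟩
  have hx := hG (affineCoord x)
  rw [chartInv_affineCoord, hQ, homPt_zero_right] at hx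
  filter_upwards [hPc.eventually_ne hP] with w hw
  rw [hG, hx, chartInv_infty, sphereInv_coe, ← homPt_mul hw 1, mul_one, mul_div_cancel₀ _ hw]

end HasSphereDeriv

lemma exists_hasSphereDeriv_of_homPt {G : OnePoint ℂ → OnePoint ℂ} {x : OnePoint ℂ} {P Q : ℂ → ℂ}
    (hG : ∀ w, G (chartInv x w) = homPt (P w) (Q w))
    (hPQ : P (affineCoord x) ≠ 0 ∨ Q (affineCoord x) ≠ 0)
    (hP : Differentiable ℂ P) (hQ : Differentiable ℂ Q) : ∃ m, HasSphereDeriv G x m := by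
  by_cases h : Q (affineCoord x) = 0
  · have h' : P (affineCoord x) ≠ 0 := by tauto
    exact ⟨_, HasSphereDeriv.of_homPt_infty hG h h' hP.continuous.continuousAt
      ((hQ _).div (hP _) h').hasDerivAt⟩
  · exact ⟨_, HasSphereDeriv.of_homPt_finite hG h hQ.continuous.continuousAt
      ((hP _).div (hQ _) h).hasDerivAt⟩

lemma det_ne_zero_GL (φ : GL (Fin 2) ℂ) : φ 0 0 * φ 1 1 - φ 0 1 * φ 1 0 ≠ 0 := by
  have := φ.det_ne_zero
  rwa [Matrix.det_fin_two] at this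

/-- Only existence matters: under conjugation this derivative cancels against that of the inverse.
The nonzero determinant excludes a common zero of the two linear forms. -/
lemma exists_hasSphereDeriv_smul (φ : GL (Fin 2) ℂ) (x : OnePoint ℂ) :
    ∃ m, HasSphereDeriv (fun y => φ • y) x m := by
  have hdet := det_ne_zero_GL φ
  induction x using OnePoint.rec with
  | infty =>
    refine exists_hasSphereDeriv_of_homPt (P := fun w => φ 0 0 * 1 + φ 0 1 * w)
      (Q := fun w => φ 1 0 * 1 + φ 1 1 * w) (fun w => ?_) ?_ (by fun_prop) (by fun_prop)
    · rw [chartInv_infty, sphereInv_coe, smul_homPt]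
      simp
    · simp only [affineCoord_infty]
      by_contra! h
      apply hdet
      linear_combination φ 1 1 * h.1 - φ 0 1 * h.2
  | coe z =>
    refine exists_hasSphereDeriv_of_homPt (P := fun w => φ 0 0 * w + φ 0 1 * 1)
      (Q := fun w => φ 1 0 * w + φ 1 1 * 1) (fun w => ?_) ?_ (by fun_prop) (by fun_prop)
    · rw [chartInv_coe, ← homPt_one_right, smul_homPt]
      simp
    · simp only [affineCoord_coe]
      by_contra! h
      apply hdet
      linear_combination φ 0 0 * h.2 - φ 1 0 * h.1

/-- Multipliers at fixed points are invariant under Möbius conjugacy. -/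
lemma HasSphereDeriv.conj {f g : OnePoint ℂ → OnePoint ℂ} {φ : GL (Fin 2) ℂ}
    (hφ : ∀ x, φ • f x = g (φ • x)) {x : OnePoint ℂ} {m : ℂ} (hx : f x = x)
    (h : HasSphereDeriv f x m) : HasSphereDeriv g (φ • x) m := by
  obtain ⟨a, ha⟩ := exists_hasSphereDeriv_smul φ x
  obtain ⟨b, hb⟩ := exists_hasSphereDeriv_smul φ⁻¹ (φ • x)
  have hb' : HasSphereDeriv (fun y => φ⁻¹ • y) ((fun y => φ • y) x) b := hb
  have hba : b * a = 1 := by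
    have h1 := hb'.comp ha
    have : ((fun y : OnePoint ℂ => φ⁻¹ • y) ∘ fun y => φ • y) = id := by
      funext y; simp
    rw [this] at h1
    exact h1.unique .id
  have h2 : HasSphereDeriv (f ∘ fun y => φ⁻¹ • y) (φ • x) (m * b) :=
    HasSphereDeriv.comp (by simpa using h) hb
  have hfx : (f ∘ fun y => φ⁻¹ • y) (φ • x) = x := by simp [hx]
  have h3 : HasSphereDeriv ((fun y => φ • y) ∘ (f ∘ fun y => φ⁻¹ • y)) (φ • x) (a * (m * b)) :=
    HasSphereDeriv.comp (by rwa [hfx]) h2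
  have hg : ((fun y => φ • y) ∘ (f ∘ fun y => φ⁻¹ • y)) = g := by
    funext y; simp [hφ]
  rw [hg] at h3
  rwa [show a * (m * b) = m by linear_combination m * hba] at h3

/-! ### Cycles and their multipliers -/

/-- `x` is periodic of exact period `n` for `f`, with multiplier `m`. -/
structure HasCycleMultiplier (f : OnePoint ℂ → OnePoint ℂ) (n : ℕ) (x : OnePoint ℂ) (m : ℂ) :
    Prop where
  pos : 0 < n
  minimalPeriod_eq : Function.minimalPeriod f x = n
  deriv : HasSphereDeriv f^[n] x m

lemma iterate_conj {f g : OnePoint ℂ → OnePoint ℂ} {φ : GL (Fin 2) ℂ}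
    (hφ : ∀ x, φ • f x = g (φ • x)) (n : ℕ) (x : OnePoint ℂ) :
    φ • f^[n] x = g^[n] (φ • x) := by
  have : Function.Semiconj (fun y : OnePoint ℂ => φ • y) f g := hφ
  exact this.iterate_right n x

namespace HasCycleMultiplier

variable {f g : OnePoint ℂ → OnePoint ℂ} {n : ℕ} {x : OnePoint ℂ} {m : ℂ}

lemma iterate_eq (h : HasCycleMultiplier f n x m) : f^[n] x = x := by
  have := Function.isPeriodicPt_minimalPeriod f x
  rwa [h.minimalPeriod_eq] at this

lemma conj {φ : GL (Fin 2) ℂ} (hφ : ∀ x, φ • f x = g (φ • x)) (h : HasCycleMultiplier f n x m) :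
    HasCycleMultiplier g n (φ • x) m := by
  refine ⟨h.pos, ?_, h.deriv.conj (iterate_conj hφ n) h.iterate_eq⟩
  rw [← h.minimalPeriod_eq, Function.minimalPeriod_eq_minimalPeriod_iff]
  intro k
  simp only [Function.IsPeriodicPt, Function.IsFixedPt]
  rw [← iterate_conj hφ, smul_left_cancel_iff]

lemma hasMultiplierAt (h : HasCycleMultiplier f n x m) : HasMultiplierAt f x m := by
  refine ⟨⟨n, h.pos, h.iterate_eq⟩, ?_⟩
  rw [h.minimalPeriod_eq]
  exact h.deriv.hasFixedPointMultiplier h.iterate_eq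

lemma exists_int (hf : HasOnlyIntegerMultipliers f) (h : HasCycleMultiplier f n x m) :
    ∃ k : ℤ, m = k := hf x m h.hasMultiplierAt

lemma of_isFixedPt (hx : f x = x) (h : HasSphereDeriv f x m) : HasCycleMultiplier f 1 x m :=
  ⟨one_pos, Function.minimalPeriod_eq_one_iff_isFixedPt.2 hx, h⟩

lemma fixed (h : HasCycleMultiplier f 1 x m) : f x = x := h.iterate_eq

lemma hasSphereDeriv (h : HasCycleMultiplier f 1 x m) : HasSphereDeriv f x m := h.deriv

end HasCycleMultiplier

/-- The multipliers of all cycles are integers, for cycles described by `HasCycleMultiplier`. -/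
def IntegerCycleMultipliers (f : OnePoint ℂ → OnePoint ℂ) : Prop :=
  ∀ n x m, HasCycleMultiplier f n x m → ∃ k : ℤ, m = k

namespace AreMoebiusConjugate

variable {f g h : OnePoint ℂ → OnePoint ℂ}

protected lemma symm (hfg : AreMoebiusConjugate f g) : AreMoebiusConjugate g f := by
  obtain ⟨φ, hφ⟩ := hfg
  refine ⟨φ⁻¹, fun x => ?_⟩
  rw [inv_smul_eq_iff, hφ, smul_inv_smul]

protected lemma trans (hfg : AreMoebiusConjugate f g) (hgh : AreMoebiusConjugate g h) :
    AreMoebiusConjugate f h := by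
  obtain ⟨φ, hφ⟩ := hfg
  obtain ⟨ψ, hψ⟩ := hgh
  exact ⟨ψ * φ, fun x => by rw [mul_smul, mul_smul, hφ, hψ]⟩

lemma exists_hasCycleMultiplier (hfg : AreMoebiusConjugate f g) {n : ℕ} {x : OnePoint ℂ} {m : ℂ}
    (hx : HasCycleMultiplier f n x m) : ∃ y, HasCycleMultiplier g n y m := by
  obtain ⟨φ, hφ⟩ := hfg
  exact ⟨_, hx.conj hφ⟩

lemma integerCycleMultipliers (hfg : AreMoebiusConjugate f g) (hf : IntegerCycleMultipliers f) :
    IntegerCycleMultipliers g := by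
  intro n x m hx
  obtain ⟨y, hy⟩ := hfg.symm.exists_hasCycleMultiplier hx
  exact hf n y m hy

end AreMoebiusConjugate

/-! ### Quadratic maps in homogeneous coordinates -/

/-- A pair of binary quadratic forms `a x² + b x y + c y²`, `d x² + e x y + f y²`. -/
structure QuadPair where
  (a b c d e f : ℂ)

namespace QuadPair

/-- The first form of the pair. -/
def num (F : QuadPair) (x y : ℂ) : ℂ := F.a * x ^ 2 + F.b * x * y + F.c * y ^ 2

/-- The second form of the pair. -/
def den (F : QuadPair) (x y : ℂ) : ℂ := F.d * x ^ 2 + F.e * x * y + F.f * y ^ 2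

/-- The two forms have no common zero. -/
def Nondeg (F : QuadPair) : Prop :=
  ∀ x y, (x ≠ 0 ∨ y ≠ 0) → F.num x y ≠ 0 ∨ F.den x y ≠ 0

/-- The self-map `[x : y] ↦ [F.num x y : F.den x y]` of the sphere. -/
noncomputable def toMap (F : QuadPair) : OnePoint ℂ → OnePoint ℂ := fun x =>
  x.elim (homPt F.a F.d) (fun z => homPt (F.num z 1) (F.den z 1))

variable (F : QuadPair)

lemma toMap_infty : F.toMap ∞ = homPt F.a F.d := rfl

lemma toMap_coe (z : ℂ) : F.toMap (z : OnePoint ℂ) = homPt (F.num z 1) (F.den z 1) := rfl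

lemma toMap_homPt {x y : ℂ} (h : x ≠ 0 ∨ y ≠ 0) :
    F.toMap (homPt x y) = homPt (F.num x y) (F.den x y) := by
  by_cases hy : y = 0
  · subst hy
    have hx : x ≠ 0 := by simpa using h
    rw [homPt_zero_right, toMap_infty, ← homPt_mul (pow_ne_zero 2 hx)]
    simp [num, den, mul_comm]
  · rw [homPt_of_ne hy, toMap_coe, ← homPt_mul (pow_ne_zero 2 hy)]
    congr 1 <;> simp only [num, den] <;> field_simp

lemma ratMap_eq_toMap {p q : ℂ[X]} (h : max p.natDegree q.natDegree = 2) :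
    ratMap p q = toMap ⟨p.coeff 2, p.coeff 1, p.coeff 0, q.coeff 2, q.coeff 1, q.coeff 0⟩ := by
  have hev : ∀ (r : ℂ[X]) (z : ℂ), r.natDegree ≤ 2 →
      r.eval z = r.coeff 2 * z ^ 2 + r.coeff 1 * z * 1 + r.coeff 0 * 1 ^ 2 := by
    intro r z hr
    rw [eval_eq_sum_range' (Nat.lt_succ_of_le hr)]
    simp [Finset.sum_range_succ]
    ring
  funext x
  induction x using OnePoint.rec with
  | infty =>
    rw [toMap_infty]
    simp [ratMap, homPt, h]
  | coe z =>
    have hp := hev p z (h ▸ le_max_left _ _)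
    have hq := hev q z (h ▸ le_max_right _ _)
    rw [toMap_coe]
    simp only [num, den, ← hp, ← hq]
    simp [ratMap, homPt]

lemma nondeg_of_isCoprime {p q : ℂ[X]} (hpq : IsCoprime p q)
    (h : max p.natDegree q.natDegree = 2) :
    Nondeg ⟨p.coeff 2, p.coeff 1, p.coeff 0, q.coeff 2, q.coeff 1, q.coeff 0⟩ := by
  have hev : ∀ (r : ℂ[X]) (x y : ℂ), y ≠ 0 → r.natDegree ≤ 2 →
      r.coeff 2 * x ^ 2 + r.coeff 1 * x * y + r.coeff 0 * y ^ 2 = y ^ 2 * r.eval (x / y) := by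
    intro r x y hy hr
    rw [eval_eq_sum_range' (Nat.lt_succ_of_le hr)]
    simp [Finset.sum_range_succ]
    field_simp
    ring
  intro x y hxy
  by_contra! hcon
  simp only [num, den] at hcon
  by_cases hy : y = 0
  · subst hy
    have hx : x ≠ 0 := by simpa using hxy
    have h2 : p.coeff 2 = 0 ∧ q.coeff 2 = 0 := by simpa [hx] using hcon
    rcases max_choice p.natDegree q.natDegree with h' | h' <;> rw [h] at h'
    · have := h2.1
      rw [h', coeff_natDegree, leadingCoeff_eq_zero] at this
      simp [this] at h'
    · have := h2.2
      rw [h', coeff_natDegree, leadingCoeff_eq_zero] at this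
      simp [this] at h'
  · rw [hev p x y hy (h ▸ le_max_left _ _), hev q x y hy (h ▸ le_max_right _ _)] at hcon
    obtain ⟨u, v, huv⟩ := hpq
    have := congrArg (eval (x / y)) huv
    have h1 : p.eval (x / y) = 0 := by simpa [hy] using hcon.1
    have h2 : q.eval (x / y) = 0 := by simpa [hy] using hcon.2
    simp [h1, h2] at this

variable {F} {G : QuadPair}

lemma Nondeg.of_conj (hF : F.Nondeg) {A B C D : ℂ} (hdet : A * D - B * C ≠ 0) {κ : ℂ}
    (h₁ : ∀ x y, A * F.num x y + B * F.den x y = κ * G.num (A * x + B * y) (C * x + D * y))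
    (h₂ : ∀ x y, C * F.num x y + D * F.den x y = κ * G.den (A * x + B * y) (C * x + D * y)) :
    G.Nondeg := by
  intro X Y hXY
  by_contra! hcon
  set δ := A * D - B * C with hδ
  -- The two fractions are the coordinates of the preimage of `(X, Y)` under the matrix `(A B; C
  -- D)`; it would be a common zero of the forms of `F`.
  have e₁ : A * ((D * X - B * Y) / δ) + B * ((A * Y - C * X) / δ) = X := by
    field_simp
    rw [hδ]; ring
  have e₂ : C * ((D * X - B * Y) / δ) + D * ((A * Y - C * X) / δ) = Y := by
    field_simp
    rw [hδ]; ring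
  have k₁ := h₁ ((D * X - B * Y) / δ) ((A * Y - C * X) / δ)
  have k₂ := h₂ ((D * X - B * Y) / δ) ((A * Y - C * X) / δ)
  rw [e₁, e₂, hcon.1] at k₁
  rw [e₁, e₂, hcon.2] at k₂
  have hne : (D * X - B * Y) / δ ≠ 0 ∨ (A * Y - C * X) / δ ≠ 0 := by
    by_contra! h
    rw [h.1, h.2] at e₁ e₂
    simp only [mul_zero, add_zero] at e₁ e₂
    rcases hXY with h | h
    · exact h e₁.symm
    · exact h e₂.symm
  rcases hF _ _ hne with h | h <;> apply h
  · have : δ * F.num ((D * X - B * Y) / δ) ((A * Y - C * X) / δ) = 0 := by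
      rw [hδ]; linear_combination D * k₁ - B * k₂
    exact (mul_eq_zero.1 this).resolve_left hdet
  · have : δ * F.den ((D * X - B * Y) / δ) ((A * Y - C * X) / δ) = 0 := by
      rw [hδ]; linear_combination A * k₂ - C * k₁
    exact (mul_eq_zero.1 this).resolve_left hdet

/-- The Möbius transformation with matrix `(A B; C D)`. -/
noncomputable def moebius {A B C D : ℂ} (hdet : A * D - B * C ≠ 0) : GL (Fin 2) ℂ :=
  Matrix.GeneralLinearGroup.mkOfDetNeZero !![A, B; C, D] (by rwa [Matrix.det_fin_two_of])

lemma moebius_smul_homPt {A B C D : ℂ} (hdet : A * D - B * C ≠ 0) {x y : ℂ}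
    (h : x ≠ 0 ∨ y ≠ 0) : moebius hdet • homPt x y = homPt (A * x + B * y) (C * x + D * y) := by
  rw [smul_homPt _ h]
  simp [moebius, Matrix.GeneralLinearGroup.mkOfDetNeZero]

lemma Nondeg.moebius_smul_toMap (hF : F.Nondeg) {A B C D : ℂ} (hdet : A * D - B * C ≠ 0) {κ : ℂ}
    (hκ : κ ≠ 0)
    (h₁ : ∀ x y, A * F.num x y + B * F.den x y = κ * G.num (A * x + B * y) (C * x + D * y))
    (h₂ : ∀ x y, C * F.num x y + D * F.den x y = κ * G.den (A * x + B * y) (C * x + D * y))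
    (x : OnePoint ℂ) : moebius hdet • F.toMap x = G.toMap (moebius hdet • x) := by
  obtain ⟨u, v, huv, rfl⟩ := exists_homPt x
  have hne : A * u + B * v ≠ 0 ∨ C * u + D * v ≠ 0 := by
    by_contra! h
    rcases huv with hu | hv
    · apply mul_ne_zero hdet hu
      linear_combination D * h.1 - B * h.2
    · apply mul_ne_zero hdet hv
      linear_combination A * h.2 - C * h.1
  rw [toMap_homPt _ huv, moebius_smul_homPt _ huv, moebius_smul_homPt _ (hF u v huv),
    toMap_homPt _ hne, h₁, h₂, homPt_mul hκ]

lemma Nondeg.areMoebiusConjugate (hF : F.Nondeg) (A B C D : ℂ) (hdet : A * D - B * C ≠ 0) (κ : ℂ)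
    (hκ : κ ≠ 0)
    (h₁ : ∀ x y, A * F.num x y + B * F.den x y = κ * G.num (A * x + B * y) (C * x + D * y))
    (h₂ : ∀ x y, C * F.num x y + D * F.den x y = κ * G.den (A * x + B * y) (C * x + D * y)) :
    AreMoebiusConjugate F.toMap G.toMap :=
  ⟨moebius hdet, hF.moebius_smul_toMap hdet hκ h₁ h₂⟩

/-! ### Multipliers of quadratic maps -/

lemma hasDerivAt_quadratic (a b c z : ℂ) :
    HasDerivAt (fun w => a * w ^ 2 + b * w + c) (2 * a * z + b) z := by
  have h := (((hasDerivAt_pow 2 z).const_mul a).add ((hasDerivAt_id z).const_mul b)).add_const c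
  refine HasDerivAt.congr_deriv (f := fun w => a * w ^ 2 + b * w + c) h ?_
  push_cast
  ring

lemma hasSphereDeriv_infty (hd : F.d = 0) (ha : F.a ≠ 0) :
    HasSphereDeriv F.toMap ∞ (F.e / F.a) := by
  have hnum : F.num 1 = fun w => F.c * w ^ 2 + F.b * w + F.a := by
    funext w; simp only [num]; ring
  have hden : F.den 1 = fun w => F.f * w ^ 2 + F.e * w + 0 := by
    funext w; simp only [den, hd]; ring
  refine HasSphereDeriv.of_homPt_infty (P := F.num 1) (Q := F.den 1) (fun w => ?_) ?_ ?_ ?_ ?_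
  · rw [chartInv_infty, sphereInv_coe, toMap_homPt _ (by simp)]
  · simp [affineCoord_infty, den, hd]
  · simpa [affineCoord_infty, num] using ha
  · rw [hnum]; fun_prop
  · rw [hnum, hden, affineCoord_infty]
    refine ((hasDerivAt_quadratic F.f F.e 0 0).div (hasDerivAt_quadratic F.c F.b F.a 0)
      (by simpa using ha)).congr_deriv ?_
    simp
    field_simp

lemma hasSphereDeriv_coe {z : ℂ} (hz : F.den z 1 ≠ 0) :
    HasSphereDeriv F.toMap (z : OnePoint ℂ)
      (((2 * F.a * z + F.b) * F.den z 1 - F.num z 1 * (2 * F.d * z + F.e)) / F.den z 1 ^ 2) := by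
  have hnum : (fun w => F.num w 1) = fun w => F.a * w ^ 2 + F.b * w + F.c := by
    funext w; simp only [num]; ring
  have hden : (fun w => F.den w 1) = fun w => F.d * w ^ 2 + F.e * w + F.f := by
    funext w; simp only [den]; ring
  have hn := hasDerivAt_quadratic F.a F.b F.c z
  have hd := hasDerivAt_quadratic F.d F.e F.f z
  rw [← hnum] at hn
  rw [← hden] at hd
  exact HasSphereDeriv.of_homPt_finite (P := fun w => F.num w 1) (Q := fun w => F.den w 1)
    (fun w => by rw [chartInv_coe, toMap_coe]) hz hd.continuousAt (hn.div hd hz)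

end QuadPair

/-- The multiplier of a cycle of prime length all of whose points are finite. -/
lemma hasCycleMultiplier_of_orbit {f : OnePoint ℂ → OnePoint ℂ} {F F' : ℂ → ℂ} {p : ℕ}
    [hp : Fact p.Prime] {z : ℂ} (h : ∀ i < p, f (F^[i] z : ℂ) = (F (F^[i] z) : ℂ))
    (hd : ∀ i < p, HasSphereDeriv f (F^[i] z : ℂ) (F' (F^[i] z))) (hz : F^[p] z = z)
    (hne : F z ≠ z) :
    HasCycleMultiplier f p (z : OnePoint ℂ) (∏ i ∈ Finset.range p, F' (F^[i] z)) := by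
  have hit : ∀ i ≤ p, f^[i] (z : OnePoint ℂ) = (F^[i] z : ℂ) := by
    intro i
    induction i with
    | zero => simp
    | succ i ih =>
      intro hi
      rw [Function.iterate_succ_apply', ih (by omega), h i (by omega),
        Function.iterate_succ_apply']
  have hder : ∀ i ≤ p, HasSphereDeriv f^[i] (z : OnePoint ℂ)
      (∏ j ∈ Finset.range i, F' (F^[j] z)) := by
    intro i
    induction i with
    | zero => intro _; simpa using HasSphereDeriv.id
    | succ i ih =>
      intro hi
      rw [Finset.prod_range_succ, mul_comm, Function.iterate_succ']
      refine HasSphereDeriv.comp ?_ (ih (by omega))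
      rw [hit i (by omega)]
      exact hd i (by omega)
  -- As `p` is prime, a point fixed by the `p`th iterate but not by `f` has minimal period `p`.
  refine ⟨hp.out.pos, Function.minimalPeriod_eq_prime ?_ ?_, hder p le_rfl⟩
  · rw [Function.IsPeriodicPt, Function.IsFixedPt, hit p le_rfl, hz]
  · have := h 0 hp.out.pos
    rw [Function.IsFixedPt]
    simp only [Function.iterate_zero, id] at this
    rw [this]
    exact fun h' => hne (OnePoint.coe_injective h')

namespace QuadPair

/-! ### Normal forms -/

/-- The quadratic polynomial `z ^ 2 + c`. -/
def poly (c : ℂ) : QuadPair := ⟨1, 0, c, 0, 0, 1⟩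

/-- The map `w ↦ α w + β + γ / w`. -/
def laurent (α β γ : ℂ) : QuadPair := ⟨α, β, γ, 0, 1, 0⟩

lemma poly_toMap_coe (c z : ℂ) : (poly c).toMap (z : OnePoint ℂ) =
    ((z ^ 2 + c : ℂ) : OnePoint ℂ) := by
  rw [toMap_coe, ← homPt_one_right]
  simp [poly, num, den]

lemma poly_hasSphereDeriv (c z : ℂ) : HasSphereDeriv (poly c).toMap (z : OnePoint ℂ) (2 * z) := by
  have h := hasSphereDeriv_coe (F := poly c) (z := z) (by simp [poly, den])
  simpa [poly, num, den] using h

lemma laurent_toMap_coe (α β γ : ℂ) {w : ℂ} (hw : w ≠ 0) :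
    (laurent α β γ).toMap (w : OnePoint ℂ) = ((α * w + β + γ / w : ℂ) : OnePoint ℂ) := by
  have hden : (laurent α β γ).den w 1 = w := by simp [laurent, den]
  rw [toMap_coe, hden, homPt_of_ne hw]
  congr 1
  simp only [laurent, num]
  field_simp

lemma laurent_hasSphereDeriv (α β γ : ℂ) {w : ℂ} (hw : w ≠ 0) :
    HasSphereDeriv (laurent α β γ).toMap (w : OnePoint ℂ) (α - γ / w ^ 2) := by
  have hden : (laurent α β γ).den w 1 = w := by simp [laurent, den]
  have h := hasSphereDeriv_coe (F := laurent α β γ) (z := w) (by rwa [hden])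
  rw [hden] at h
  convert h using 1
  simp only [laurent, num]
  field_simp
  ring

lemma laurent_nondeg {α β γ : ℂ} (hα : α ≠ 0) (hγ : γ ≠ 0) : (laurent α β γ).Nondeg := by
  intro x y h
  by_contra! hc
  simp only [laurent, num, den] at hc
  have hxy : x * y = 0 := by linear_combination hc.2
  rcases mul_eq_zero.1 hxy with h0 | h0
  · have hy : y = 0 := by simpa [h0, hγ] using hc.1
    simp [h0, hy] at h
  · have hx : x = 0 := by simpa [h0, hα] using hc.1
    simp [h0, hx] at h

lemma laurent_hasCycleMultiplier {α β γ : ℂ} {p : ℕ} [Fact p.Prime] {F : ℂ → ℂ} {z : ℂ}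
    (hF : ∀ w, F w = α * w + β + γ / w) (h0 : ∀ i < p, F^[i] z ≠ 0) (hz : F^[p] z = z)
    (hne : F z ≠ z) :
    HasCycleMultiplier (laurent α β γ).toMap p (z : OnePoint ℂ)
      (∏ i ∈ Finset.range p, (α - γ / (F^[i] z) ^ 2)) := by
  refine hasCycleMultiplier_of_orbit (F := F) (F' := fun w => α - γ / w ^ 2) ?_ ?_ hz hne
  · intro i hi
    rw [laurent_toMap_coe _ _ _ (h0 i hi), hF]
  · intro i hi
    exact laurent_hasSphereDeriv _ _ _ (h0 i hi)

lemma poly_hasCycleMultiplier {c : ℂ} {p : ℕ} [Fact p.Prime] {F : ℂ → ℂ} {z : ℂ}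
    (hF : ∀ w, F w = w ^ 2 + c) (hz : F^[p] z = z) (hne : F z ≠ z) :
    HasCycleMultiplier (poly c).toMap p (z : OnePoint ℂ)
      (∏ i ∈ Finset.range p, 2 * (F^[i] z)) := by
  refine hasCycleMultiplier_of_orbit (F := F) (F' := fun w => 2 * w) ?_ ?_ hz hne
  · intro i _
    rw [poly_toMap_coe, hF]
  · intro i _
    exact poly_hasSphereDeriv _ _

end QuadPair

/-! ### Cycles of length three -/

lemma exists_cubic_root (b c d : ℂ) : ∃ z : ℂ, z ^ 3 + b * z ^ 2 + c * z + d = 0 := by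
  have hdeg : (Cubic.mk 1 b c d).toPoly.degree ≠ 0 := by
    rw [Cubic.degree_of_a_ne_zero (by simp)]
    norm_num
  obtain ⟨z, hz⟩ := IsAlgClosed.exists_root _ hdeg
  refine ⟨z, ?_⟩
  simpa [Cubic.toPoly, IsRoot] using hz

lemma exists_quadratic_root (b c : ℂ) : ∃ z : ℂ, z ^ 2 + b * z + c = 0 := by
  obtain ⟨t, ht⟩ := IsAlgClosed.exists_pow_nat_eq (b ^ 2 - 4 * c) (n := 2) (by norm_num)
  exact ⟨(t - b) / 2, by linear_combination ht / 4⟩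

/-! ### Integer equations expressing that a discriminant is a square. -/

lemma Int.exists_sq_of_sq_mul_eq_sq {d k M : ℤ} (hd : d ≠ 0) (h : d ^ 2 * k = M ^ 2) :
    ∃ j : ℤ, k = j ^ 2 := by
  have hdvd : d ∣ M := (Int.pow_dvd_pow_iff two_ne_zero).1 ⟨k, h.symm⟩
  obtain ⟨j, rfl⟩ := hdvd
  exact ⟨j, mul_left_cancel₀ (pow_ne_zero 2 hd) (by linear_combination h)⟩

lemma sq_eq_nine_of_sq_sub_eight {n j : ℤ} (h : n ^ 2 - 8 = j ^ 2) : n ^ 2 = 9 := by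
  have h1 : |j| < |n| := sq_lt_sq.1 (by linarith)
  rw [← sq_abs n, ← sq_abs j] at h
  rw [← sq_abs n]
  have hj := abs_nonneg j
  generalize |n| = n at *
  generalize |j| = j at *
  -- Since `j ≤ n - 1`, the difference `8 = n² - j²` is at least `2n - 1`.
  have h2 : n ≤ 4 := by nlinarith
  have h3 : j ≤ 4 := by omega
  have h4 : 0 ≤ n := by omega
  interval_cases n <;> interval_cases j <;> simp_all

/-- Completing the square turns the equation into a factorisation of 9. -/
lemma eq_of_sq_sub_three_mul {a j : ℤ} (ha : a ≠ 0) (h : a ^ 2 - 3 * a = j ^ 2) :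
    a = -1 ∨ a = 3 ∨ a = 4 := by
  have hprod : (2 * a - 3 - 2 * j) * (2 * a - 3 + 2 * j) = 9 := by linear_combination 4 * h
  have hdvd : (2 * a - 3 - 2 * j) ∣ 9 := ⟨_, hprod.symm⟩
  have hle := Int.le_of_dvd (by norm_num) hdvd
  have hge := Int.le_of_dvd (by norm_num) ((neg_dvd).2 hdvd)
  generalize hu : 2 * a - 3 - 2 * j = u at *
  have hu' : 2 * a - 3 + 2 * j = 4 * a - 6 - u := by linarith
  rw [hu'] at hprod
  have : -9 ≤ u := by linarith
  interval_cases u <;> omega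

open QuadPair

/-- The sum `s` of the points of a 3-cycle is a root of `s² + s + 2 + c`, of discriminant `n² - 8`;
the points are the roots of a cubic with coefficients in `c` and `s`. The multiplier is affine in
`s`, with slope `8c`. -/
lemma poly_sq_of_integerCycleMultipliers {n : ℤ} {c : ℂ} (hc : 4 * c = 1 - (n : ℂ) ^ 2)
    (h : IntegerCycleMultipliers (poly c).toMap) : n ^ 2 = 1 ∨ n ^ 2 = 9 := by
  obtain ⟨s, hs⟩ := exists_quadratic_root 1 (2 + c)
  obtain ⟨z, hz⟩ := exists_cubic_root (-s) (c - s - 1) (-(1 + c + c * s))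
  set F : ℂ → ℂ := fun w => w ^ 2 + c with hF
  have hF2 : F (F z) = s - z - F z := by
    simp only [hF]
    linear_combination (z + s) * hz + (z ^ 2 + z + c) * hs
  have hF3 : F (F (F z)) = z := by
    rw [hF2]
    simp only [hF]
    linear_combination (z + 2 + s) * hz + (z ^ 2 + z + 1 + c) * hs
  -- If the cycle collapsed to a fixed point, its multiplier `2z` would be a primitive cube root of
  -- unity, forcing `n⁴ - 3n² + 9 = 0`.
  have hne : F z ≠ z := by
    intro hfix
    have h3 : 3 * z = s := by rw [hfix, hfix] at hF2; linear_combination hF2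
    have hfix' : z ^ 2 + c = z := hfix
    have h4 : 4 * z ^ 2 + 2 * z + 1 = 0 := by
      rw [← h3] at hs
      linear_combination (hs - hfix') / 2
    have hy : -6 * z = (n : ℂ) ^ 2 := by
      linear_combination 4 * hfix' - hc - h4
    have h5 : (n : ℂ) ^ 4 - 3 * (n : ℂ) ^ 2 + 9 = 0 := by
      rw [show (n : ℂ) ^ 4 = ((n : ℂ) ^ 2) ^ 2 by ring, ← hy]
      linear_combination 9 * h4
    have h6 : n ^ 4 - 3 * n ^ 2 + 9 = 0 := by exact_mod_cast h5
    nlinarith [sq_nonneg (n ^ 2 - 2)]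
  have : Fact (Nat.Prime 3) := ⟨Nat.prime_three⟩
  obtain ⟨m, hm⟩ := h _ _ _ (poly_hasCycleMultiplier (p := 3) (fun w => rfl) hF3 hne)
  have hprod : F z * F (F z) = z ^ 2 - s * z + (c - s - 1) := by
    rw [hF2]
    simp only [hF]
    linear_combination -((z + 1 + s) * hz + (z ^ 2 + z + c) * hs)
  have hm' : (m : ℂ) = 8 * (1 + c + c * s) := by
    rw [← hm]
    simp only [Finset.prod_range_succ, Finset.prod_range_zero, Function.iterate_succ,
      Function.iterate_zero, Function.comp, id]
    linear_combination 8 * z * hprod + 8 * hz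
  have hsq : (1 - (n : ℂ) ^ 2) ^ 2 * ((n : ℂ) ^ 2 - 8) = ((m : ℂ) - 9 + (n : ℂ) ^ 2) ^ 2 := by
    have h1 : (m : ℂ) - 9 + (n : ℂ) ^ 2 = (1 - (n : ℂ) ^ 2) * (2 * s + 1) := by
      rw [hm', ← hc]; linear_combination hc
    have h2 : (2 * s + 1) ^ 2 = (n : ℂ) ^ 2 - 8 := by linear_combination 4 * hs - hc
    rw [h1, ← h2]; ring
  have hsq' : (1 - n ^ 2) ^ 2 * (n ^ 2 - 8) = (m - 9 + n ^ 2) ^ 2 := by exact_mod_cast hsq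
  by_cases hn : n ^ 2 = 1
  · exact .inl hn
  · obtain ⟨j, hj⟩ := Int.exists_sq_of_sq_mul_eq_sq (sub_ne_zero.2 (Ne.symm hn)) hsq'
    exact .inr (sq_eq_nine_of_sq_sub_eight hj)

/-- For a 3-cycle with sum `s - 1`, summing `F w = w + 1 + k/w` over the cycle gives `∑ 1/w = -3/k`.
The elementary symmetric functions are `s - 1`, `-s`, `ks/3`, where `s² + 2s + 3k = 0`, and again
the multiplier is affine in `s`. -/
lemma laurent_eq_of_integerCycleMultipliers {a : ℤ} (ha : a ≠ 0) {k : ℂ} (hk : k * a = 1)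
    (h : IntegerCycleMultipliers (laurent 1 1 k).toMap) : a = -1 ∨ a = 3 ∨ a = 4 := by
  have hk0 : k ≠ 0 := left_ne_zero_of_mul_eq_one hk
  obtain ⟨s, hs⟩ := exists_quadratic_root 2 (3 * k)
  have hs0 : s ≠ 0 := by
    rintro rfl
    apply hk0
    linear_combination hs / 3
  obtain ⟨w, hw⟩ := exists_cubic_root (-(s - 1)) (-s) (-(k * s / 3))
  have hw0 : w ≠ 0 := by
    rintro rfl
    apply mul_ne_zero hk0 hs0
    linear_combination -3 * hw
  obtain ⟨F, hF⟩ : ∃ F : ℂ → ℂ, ∀ w, F w = 1 * w + 1 + k / w := ⟨_, fun _ => rfl⟩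
  obtain ⟨w₁, hw₁⟩ : ∃ w₁, w₁ = F w := ⟨_, rfl⟩
  obtain ⟨w₂, hw₂⟩ : ∃ w₂, w₂ = s - 1 - w - w₁ := ⟨_, rfl⟩
  -- The cubic gives `ks/(3w)` as a polynomial in `w`, so after multiplication by `s` the whole
  -- orbit is polynomial in `w`.
  have hsw₁ : s * w₁ = 3 * w ^ 2 + (3 - 2 * s) * w - 2 * s := by
    rw [hw₁, hF]
    field_simp
    linear_combination (-3) * hw
  have hsw₂ : s * w₂ = -3 * w ^ 2 + (s - 3) * w + s ^ 2 + s := by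
    linear_combination s * hw₂ - hsw₁
  have h₁₂ : w₁ * w₂ = w ^ 2 - (s - 1) * w - s := by
    refine mul_left_cancel₀ (pow_ne_zero 2 hs0) ?_
    rw [show s ^ 2 * (w₁ * w₂) = (s * w₁) * (s * w₂) by ring, hsw₁, hsw₂]
    linear_combination (-9 * w - 9) * hw - s * (w + 1) * hs
  have hprod : w * w₁ * w₂ = k * s / 3 := by linear_combination w * h₁₂ + hw
  have hprod0 : w * w₁ * w₂ ≠ 0 := by rw [hprod]; simp [hk0, hs0]
  have hw₁0 : w₁ ≠ 0 := fun h0 => hprod0 (by simp [h0])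
  have hw₂0 : w₂ ≠ 0 := fun h0 => hprod0 (by simp [h0])
  have hF₁ : F w₁ = w₂ := by
    have : w₁ * w₂ = w₁ ^ 2 + w₁ + k := by
      refine mul_left_cancel₀ (pow_ne_zero 2 hs0) ?_
      rw [show s ^ 2 * (w₁ * w₂) = (s * w₁) * (s * w₂) by ring,
        show s ^ 2 * (w₁ ^ 2 + w₁ + k) = (s * w₁) ^ 2 + s * (s * w₁) + s ^ 2 * k by ring,
        hsw₁, hsw₂]
      linear_combination (-18 * w - 18 + 3 * s) * hw - 2 * s * (w + 1) * hs
    rw [hF]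
    field_simp
    linear_combination -this
  have hF₂ : F w₂ = w := by
    have : w₂ * w = w₂ ^ 2 + w₂ + k := by
      refine mul_left_cancel₀ (pow_ne_zero 2 hs0) ?_
      rw [show s ^ 2 * (w₂ * w) = s * (s * w₂) * w by ring,
        show s ^ 2 * (w₂ ^ 2 + w₂ + k) = (s * w₂) ^ 2 + s * (s * w₂) + s ^ 2 * k by ring, hsw₂]
      linear_combination -(9 * w + 9 + 6 * s) * hw - s * (w + 1 + s) * hs
    rw [hF]
    field_simp
    linear_combination -this
  -- A collapsed cycle is a triple root of the cubic; this forces `a² - 3a + 3 = 0`, of negative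
  -- discriminant.
  have hne : F w ≠ w := by
    rw [← hw₁]
    rintro rfl
    have h21 : w₂ = w₁ := by rw [← hF₁, ← hw₁]
    rw [h21] at hw₂ h₁₂
    have h1 : s ^ 2 + s + 1 = 0 := by
      linear_combination -(s - 1) * hw₂ + 3 * h₁₂
    have h2 : (a : ℂ) * s = a - 3 := by
      linear_combination (a : ℂ) * hs - (a : ℂ) * h1 - 3 * hk
    have h3 : (a : ℂ) ^ 2 - 3 * a + 3 = 0 := by
      linear_combination ((a : ℂ) ^ 2 * h1 - (a * s + a - 3 + a) * h2) / 3
    have h4 : a ^ 2 - 3 * a + 3 = 0 := by exact_mod_cast h3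
    nlinarith [sq_nonneg (2 * a - 3)]
  have hit : F^[3] w = w := by
    simp only [Function.iterate_succ, Function.iterate_zero, Function.comp, id, ← hw₁, hF₁, hF₂]
  have : Fact (Nat.Prime 3) := ⟨Nat.prime_three⟩
  obtain ⟨m, hm⟩ := h _ _ _ (laurent_hasCycleMultiplier (p := 3) hF (by
    intro i hi
    interval_cases i <;>
      simpa only [Function.iterate_succ, Function.iterate_zero, Function.comp, id, ← hw₁, hF₁])
    hit hne)
  simp only [Finset.prod_range_succ, Finset.prod_range_zero, Function.iterate_succ,
    Function.iterate_zero, Function.comp, id, ← hw₁, hF₁, one_mul] at hm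
  have hm₁ : (w * w₁ * w₂) ^ 2 * m = (w ^ 2 - k) * (w₁ ^ 2 - k) * (w₂ ^ 2 - k) := by
    rw [← hm]
    field_simp
  have hsum : w + w₁ + w₂ = s - 1 := by rw [hw₂]; ring
  have hsum₂ : w * w₁ + w * w₂ + w₁ * w₂ = -s := by
    rw [h₁₂]; linear_combination w * hsum
  -- With `e₁, e₂, e₃` the symmetric functions of the cycle, `∏ (w² - k) = (e₃ + k e₁)² - k (e₂ +
  -- k)²`, by factoring over `±√k`.
  have hm₂ : (k * s / 3) ^ 2 * m = ((s - 1) * k + k * s / 3) ^ 2 - k * (k + -s) ^ 2 := by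
    rw [← hprod, hm₁, ← hsum, ← hsum₂]
    ring
  have hm₃ : s ^ 2 * k * m = k * (4 * s - 3) ^ 2 - 9 * (k - s) ^ 2 := by
    refine mul_left_cancel₀ hk0 ?_
    linear_combination 9 * hm₂
  have hm₄ : (m : ℂ) = 4 * a ^ 2 - 12 * a + 19 + 2 * a ^ 2 * s := by
    refine mul_left_cancel₀ (mul_ne_zero (pow_ne_zero 2 hs0) (pow_ne_zero 2 hk0)) ?_
    have h1 : s ^ 2 * k ^ 2 * (4 * a ^ 2 - 12 * a + 19 + 2 * a ^ 2 * s) =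
        s ^ 2 * (4 - 12 * k + 19 * k ^ 2 + 2 * s) := by
      linear_combination s ^ 2 * ((4 + 2 * s) * (k * a + 1) - 12 * k) * hk
    have hks : k = -(s ^ 2 + 2 * s) / 3 := by linear_combination hs / 3
    rw [h1, show s ^ 2 * k ^ 2 * m = k * (s ^ 2 * k * m) by ring, hm₃, hks]
    ring
  -- Here `m - 2a² + 12a - 19 = 2a²(s + 1)` and `(s + 1)² = 1 - 3k`.
  have hsq : (2 * (a : ℂ)) ^ 2 * ((a : ℂ) ^ 2 - 3 * a) = (m - 2 * a ^ 2 + 12 * a - 19) ^ 2 := by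
    rw [hm₄]
    linear_combination -4 * (a : ℂ) ^ 4 * hs + 12 * (a : ℂ) ^ 3 * hk
  have hsq' : (2 * a) ^ 2 * (a ^ 2 - 3 * a) = (m - 2 * a ^ 2 + 12 * a - 19) ^ 2 := by
    exact_mod_cast hsq
  obtain ⟨j, hj⟩ := Int.exists_sq_of_sq_mul_eq_sq (mul_ne_zero two_ne_zero ha) hsq'
  exact eq_of_sq_sub_three_mul ha hj

/-! ### Real cycles of length five -/

section RealCycles

open Finset

lemma abs_inv_sub_inv_le {x X e : ℝ} (he : e < |X|) (h : |x - X| ≤ e) :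
    |x⁻¹ - X⁻¹| ≤ e / (|X| * (|X| - e)) := by
  have hx : |X| - e ≤ |x| := by
    have := abs_sub_abs_le_abs_sub X x
    rw [abs_sub_comm] at this
    linarith
  have hX0 : 0 < |X| := (abs_nonneg _).trans_lt ((h.trans_lt he))
  have hx0 : 0 < |x| := by linarith
  have hX1 : X ≠ 0 := abs_pos.1 hX0
  have hx1 : x ≠ 0 := abs_pos.1 hx0
  rw [inv_sub_inv hx1 hX1, abs_div, abs_mul, abs_sub_comm, mul_comm |x|]
  have : 0 < |X| - e := by linarith
  gcongr
  linarith [abs_nonneg (x - X)]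

lemma abs_laurent_sub_le {α β γ x X Y e e' : ℝ} (he : e < |X|) (h : |x - X| ≤ e)
    (hY : |α * X + β + γ / X - Y| + |α| * e + |γ| * (e / (|X| * (|X| - e))) ≤ e') :
    |α * x + β + γ / x - Y| ≤ e' := by
  refine le_trans ?_ hY
  have key : α * x + β + γ / x - Y =
      (α * X + β + γ / X - Y) + α * (x - X) + γ * (x⁻¹ - X⁻¹) := by
    rw [div_eq_mul_inv, div_eq_mul_inv]; ring
  rw [key]
  refine (abs_add_three _ _ _).trans ?_
  rw [abs_mul, abs_mul]
  gcongr
  exact abs_inv_sub_inv_le he h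

lemma abs_laurent_deriv_sub_le {α γ x X e : ℝ} (he : e < |X|) (h : |x - X| ≤ e) :
    |(α - γ / x ^ 2) - (α - γ / X ^ 2)| ≤
      |γ| * (e / (|X| * (|X| - e)) * (2 / |X| + e / (|X| * (|X| - e)))) := by
  have hi := abs_inv_sub_inv_le he h
  have key : (α - γ / x ^ 2) - (α - γ / X ^ 2) =
      -γ * ((x⁻¹ - X⁻¹) * (2 * X⁻¹ + (x⁻¹ - X⁻¹))) := by
    rw [div_eq_mul_inv, div_eq_mul_inv, ← inv_pow, ← inv_pow]; ring
  rw [key, abs_mul, abs_mul, abs_neg]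
  have h2 : |2 * X⁻¹ + (x⁻¹ - X⁻¹)| ≤ 2 / |X| + e / (|X| * (|X| - e)) := by
    refine (abs_add_le _ _).trans (add_le_add ?_ hi)
    rw [abs_mul, abs_inv, abs_two, div_eq_mul_inv]
  exact mul_le_mul_of_nonneg_left (mul_le_mul hi h2 (abs_nonneg _) ((abs_nonneg _).trans hi))
    (abs_nonneg _)

/-- Put `a = b + δ` and expand: each term containing some `δ` is bounded by the matching term of `∏
(|b| + η)`. -/
lemma abs_prod_sub_prod_le {a b η : ℕ → ℝ} {n : ℕ} (h : ∀ i < n, |a i - b i| ≤ η i) :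
    |∏ i ∈ range n, a i - ∏ i ∈ range n, b i| ≤
      ∏ i ∈ range n, (|b i| + η i) - ∏ i ∈ range n, |b i| := by
  induction n with
  | zero => simp
  | succ n ih =>
    have ih := ih fun i hi => h i (by omega)
    have hn := h n (by omega)
    simp only [prod_range_succ]
    set A := ∏ i ∈ range n, a i
    set B := ∏ i ∈ range n, b i with hB
    have habs : ∏ i ∈ range n, |b i| = |B| := by rw [hB, abs_prod]
    rw [habs] at ih ⊢
    set E := ∏ i ∈ range n, (|b i| + η i)
    have key : A * a n - B * b n = (A - B) * (b n) + (A - B) * (a n - b n) + B * (a n - b n) := by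
      ring
    rw [key]
    refine (abs_add_three _ _ _).trans ?_
    rw [abs_mul, abs_mul, abs_mul]
    have hE : 0 ≤ E - |B| := (abs_nonneg _).trans ih
    calc |A - B| * |b n| + |A - B| * |a n - b n| + |B| * |a n - b n|
        ≤ (E - |B|) * |b n| + (E - |B|) * η n + |B| * η n := by gcongr
      _ = E * (|b n| + η n) - |B| * |b n| := by ring

/-- A real orbit of `w ↦ α w + β + γ / w` which closes up after five steps up to a small error
is followed by a cycle, whose multiplier lies in a small interval. -/
lemma not_integerCycleMultipliers_laurent {α β γ : ℝ} (X e : ℕ → ℝ) (N : ℤ)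
    {F : ℝ → ℝ} (hF : ∀ x, F x = α * x + β + γ / x) {D η : ℕ → ℝ}
    (hD : ∀ i, D i = α - γ / X i ^ 2)
    (hη : ∀ i, η i = |γ| * (e i / (|X i| * (|X i| - e i)) *
      (2 / |X i| + e i / (|X i| * (|X i| - e i)))))
    (he : ∀ i < 5, e i < |X i|)
    (hstep : ∀ i < 4, |α * X i + β + γ / X i - X (i + 1)| + |α| * e i +
      |γ| * (e i / (|X i| * (|X i| - e i))) ≤ e (i + 1))
    (hsign : (F^[5] (X 0 - e 0) - (X 0 - e 0)) * (F^[5] (X 0 + e 0) - (X 0 + e 0)) ≤ 0)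
    (he0 : 0 ≤ e 0) (hne : e 0 + e 1 < |X 1 - X 0|)
    (hlo : N < ∏ i ∈ range 5, D i - (∏ i ∈ range 5, (|D i| + η i) - ∏ i ∈ range 5, |D i|))
    (hhi : ∏ i ∈ range 5, D i + (∏ i ∈ range 5, (|D i| + η i) - ∏ i ∈ range 5, |D i|) < N + 1) :
    ¬ IntegerCycleMultipliers (laurent α β γ).toMap := by
  intro h
  have horb : ∀ x, |x - X 0| ≤ e 0 → ∀ i < 5, |F^[i] x - X i| ≤ e i := by
    intro x hx i
    induction i with
    | zero => intro _; simpa using hx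
    | succ i ih =>
      intro hi
      rw [Function.iterate_succ_apply', hF]
      exact abs_laurent_sub_le (he i (by omega)) (ih (by omega)) (hstep i (by omega))
  have hnz : ∀ x, |x - X 0| ≤ e 0 → ∀ i < 5, F^[i] x ≠ 0 := by
    intro x hx i hi h0
    have := horb x hx i hi
    rw [h0, zero_sub, abs_neg] at this
    linarith [he i hi]
  have huIcc : ∀ x ∈ Set.uIcc (X 0 - e 0) (X 0 + e 0), |x - X 0| ≤ e 0 := by
    intro x hx
    rw [Set.uIcc_of_le (by linarith)] at hx
    rw [abs_le]
    constructor <;> linarith [hx.1, hx.2]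
  have hcont : ∀ i ≤ 5, ContinuousOn F^[i] (Set.uIcc (X 0 - e 0) (X 0 + e 0)) := by
    intro i
    induction i with
    | zero => intro _; exact continuousOn_id
    | succ i ih =>
      intro hi
      have ih := ih (by omega)
      have : F^[i + 1] = fun x => α * F^[i] x + β + γ / F^[i] x := by
        funext x
        rw [Function.iterate_succ_apply', hF]
      rw [this]
      exact ((continuousOn_const.mul ih).add continuousOn_const).add
        (continuousOn_const.div ih fun x hx => hnz x (huIcc x hx) i (by omega))
  -- By `hsign`, `F^[5] x - x` changes sign on the interval; it is continuous there because the
  -- orbit stays away from the pole 0.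
  obtain ⟨x, hx, hx5⟩ : ∃ x, |x - X 0| ≤ e 0 ∧ F^[5] x = x := by
    have hmem : (0 : ℝ) ∈ Set.uIcc (F^[5] (X 0 - e 0) - (X 0 - e 0))
        (F^[5] (X 0 + e 0) - (X 0 + e 0)) := by
      rw [Set.mem_uIcc]
      rcases mul_nonpos_iff.1 hsign with h | h
      · exact .inr ⟨h.2, h.1⟩
      · exact .inl ⟨h.1, h.2⟩
    obtain ⟨x, hx, hx0⟩ := intermediate_value_uIcc ((hcont 5 le_rfl).sub continuousOn_id) hmem
    exact ⟨x, huIcc x hx, sub_eq_zero.1 hx0⟩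
  have hcast : ∀ i, (fun w : ℂ => (α : ℂ) * w + β + γ / w)^[i] (x : ℂ) = (F^[i] x : ℝ) := by
    intro i
    induction i with
    | zero => simp
    | succ i ih =>
      rw [Function.iterate_succ_apply', Function.iterate_succ_apply', ih, hF]
      push_cast
      rfl
  have : Fact (Nat.Prime 5) := ⟨Nat.prime_five⟩
  have hcyc := laurent_hasCycleMultiplier (α := α) (β := β) (γ := γ) (p := 5) (z := x)
    (fun w => rfl) (fun i hi => by
      rw [hcast]
      exact_mod_cast hnz x hx i hi) (by rw [hcast, hx5]) (by
      -- `x` lies within `e 0` of `X 0` and its image within `e 1` of `X 1`; by `hne` these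
      -- intervals are disjoint, so `x` is not fixed.
      have h1 := hcast 1
      rw [Function.iterate_one] at h1
      rw [h1]
      intro h2
      have h2' : F^[1] x = x := by exact_mod_cast h2
      have h3 := horb x hx 1 (by norm_num)
      rw [h2'] at h3
      have := abs_sub_le (X 1) x (X 0)
      rw [abs_sub_comm (X 1) x] at this
      linarith)
  obtain ⟨m, hm⟩ := h _ _ _ hcyc
  have hm' : ∏ i ∈ range 5, (α - γ / (F^[i] x) ^ 2) = (m : ℝ) := by
    simp only [hcast] at hm
    exact_mod_cast hm
  have hclose := abs_prod_sub_prod_le (n := 5) (a := fun i => α - γ / (F^[i] x) ^ 2) (b := D)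
    (η := η) (fun i hi => by
      rw [hD, hη]
      exact abs_laurent_deriv_sub_le (he i hi) (horb x hx i hi))
  rw [hm', abs_le] at hclose
  have h1 : (N : ℝ) < m := by linarith [hclose.1]
  have h2 : (m : ℝ) < N + 1 := by linarith [hclose.2]
  have h1' : N < m := by exact_mod_cast h1
  have h2' : m < N + 1 := by exact_mod_cast h2
  omega

/-- In this and the next five lemmas the first list approximates a real 5-cycle, the second gives
error radii that grow along the orbit, and the integer is the floor of the multiplier. -/
lemma not_integerCycleMultipliers_laurent_one_zero_neg_one :
    ¬ IntegerCycleMultipliers (laurent (1) (0) (-1)).toMap := by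
  have h := not_integerCycleMultipliers_laurent (α := 1) (β := 0) (γ := -1)
    (fun i => [-120773/50000, -100073/50000, -75091/50000, -20899/25000, 36027/100000].getD i 0)
    (fun i => [1/100000, 1/50000, 3/100000, 1/20000, 13/100000].getD i 0) (44)
    (fun x => rfl) (fun i => rfl) (fun i => rfl)
    (by intro i hi; interval_cases i <;> norm_num [abs_of_neg, abs_of_pos])
    (by intro i hi; interval_cases i <;> norm_num [abs_of_neg, abs_of_pos])
    (by norm_num [Function.iterate_succ])
    (by norm_num) (by norm_num [abs_of_neg, abs_of_pos])
    (by norm_num [prod_range_succ, abs_of_neg, abs_of_pos])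
    (by norm_num [prod_range_succ, abs_of_neg, abs_of_pos])
  simpa using h

lemma not_integerCycleMultipliers_laurent_one_one_neg_one :
    ¬ IntegerCycleMultipliers (laurent (1) (1) (-1)).toMap := by
  have h := not_integerCycleMultipliers_laurent (α := 1) (β := 1) (γ := -1)
    (fun i => [-529071/100000, -41017/10000, -28579/10000, -150799/100000, 7757/50000].getD i 0)
    (fun i => [1/100000, 1/50000, 3/100000, 1/25000, 7/100000].getD i 0) (75)
    (fun x => rfl) (fun i => rfl) (fun i => rfl)
    (by intro i hi; interval_cases i <;> norm_num [abs_of_neg, abs_of_pos])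
    (by intro i hi; interval_cases i <;> norm_num [abs_of_neg, abs_of_pos])
    (by norm_num [Function.iterate_succ])
    (by norm_num) (by norm_num [abs_of_neg, abs_of_pos])
    (by norm_num [prod_range_succ, abs_of_neg, abs_of_pos])
    (by norm_num [prod_range_succ, abs_of_neg, abs_of_pos])
  simpa using h

lemma not_integerCycleMultipliers_laurent_one_one_third :
    ¬ IntegerCycleMultipliers (laurent (1) (1) (1/3)).toMap := by
  have h := not_integerCycleMultipliers_laurent (α := 1) (β := 1) (γ := 1/3)
    (fun i => [-13781/12500, -40483/100000, -11411/50000, -861/1250, -17273/100000].getD i 0)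
    (fun i => [1/100000, 1/50000, 7/100000, 13/25000, 89/100000].getD i 0) (-13)
    (fun x => rfl) (fun i => rfl) (fun i => rfl)
    (by intro i hi; interval_cases i <;> norm_num [abs_of_neg, abs_of_pos])
    (by intro i hi; interval_cases i <;> norm_num [abs_of_neg, abs_of_pos])
    (by norm_num [Function.iterate_succ])
    (by norm_num) (by norm_num [abs_of_neg, abs_of_pos])
    (by norm_num [prod_range_succ, abs_of_neg, abs_of_pos])
    (by norm_num [prod_range_succ, abs_of_neg, abs_of_pos])
  simpa using h

lemma not_integerCycleMultipliers_laurent_one_one_fourth :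
    ¬ IntegerCycleMultipliers (laurent (1) (1) (1/4)).toMap := by
  have h := not_integerCycleMultipliers_laurent (α := 1) (β := 1) (γ := 1/4)
    (fun i => [-168129/50000, -243693/100000, -4811/3125, -70191/100000, -363/6250].getD i 0)
    (fun i => [1/100000, 1/50000, 3/100000, 1/25000, 7/100000].getD i 0) (-31)
    (fun x => rfl) (fun i => rfl) (fun i => rfl)
    (by intro i hi; interval_cases i <;> norm_num [abs_of_neg, abs_of_pos])
    (by intro i hi; interval_cases i <;> norm_num [abs_of_neg, abs_of_pos])
    (by norm_num [Function.iterate_succ])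
    (by norm_num) (by norm_num [abs_of_neg, abs_of_pos])
    (by norm_num [prod_range_succ, abs_of_neg, abs_of_pos])
    (by norm_num [prod_range_succ, abs_of_neg, abs_of_pos])
  simpa using h

lemma not_integerCycleMultipliers_laurent_neg_one_zero_two :
    ¬ IntegerCycleMultipliers (laurent (-1) (0) (2)).toMap := by
  have h := not_integerCycleMultipliers_laurent (α := -1) (β := 0) (γ := 2)
    (fun i => [-1467/400, 31221/10000, -4963/2000, 4189/2500, -241/500].getD i 0)
    (fun i => [1/10000, 1/5000, 3/10000, 1/2000, 9/10000].getD i 0) (-31)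
    (fun x => rfl) (fun i => rfl) (fun i => rfl)
    (by intro i hi; interval_cases i <;> norm_num [abs_of_neg, abs_of_pos])
    (by intro i hi; interval_cases i <;> norm_num [abs_of_neg, abs_of_pos])
    (by norm_num [Function.iterate_succ])
    (by norm_num) (by norm_num [abs_of_neg, abs_of_pos])
    (by norm_num [prod_range_succ, abs_of_neg, abs_of_pos])
    (by norm_num [prod_range_succ, abs_of_neg, abs_of_pos])
  simpa using h

lemma not_integerCycleMultipliers_laurent_neg_one_neg_two_four :
    ¬ IntegerCycleMultipliers (laurent (-1) (-2) (4)).toMap := by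
  have h := not_integerCycleMultipliers_laurent (α := -1) (β := -2) (γ := 4)
    (fun i => [-11389/2000, 29921/10000, -36553/10000, 5609/10000, 22849/5000].getD i 0)
    (fun i => [1/10000, 1/5000, 1/2500, 7/10000, 13/1250].getD i 0) (-35)
    (fun x => rfl) (fun i => rfl) (fun i => rfl)
    (by intro i hi; interval_cases i <;> norm_num [abs_of_neg, abs_of_pos])
    (by intro i hi; interval_cases i <;> norm_num [abs_of_neg, abs_of_pos])
    (by norm_num [Function.iterate_succ])
    (by norm_num) (by norm_num [abs_of_neg, abs_of_pos])
    (by norm_num [prod_range_succ, abs_of_neg, abs_of_pos])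
    (by norm_num [prod_range_succ, abs_of_neg, abs_of_pos])
  simpa using h

end RealCycles

namespace QuadPair

/-! ### Moving a fixed point to infinity -/

variable {F : QuadPair}

lemma Nondeg.exists_fixed (hF : F.Nondeg) : ∃ x, F.toMap x = x := by
  by_cases hd : F.d = 0
  · exact ⟨∞, by rw [toMap_infty, hd, homPt_zero_right]⟩
  · obtain ⟨z, hz⟩ := exists_cubic_root ((F.e - F.a) / F.d) ((F.f - F.b) / F.d) (-F.c / F.d)
    have hz' : z * F.den z 1 = F.num z 1 := by
      simp only [num, den]
      field_simp at hz
      linear_combination hz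
    have hden : F.den z 1 ≠ 0 := by
      intro h0
      rw [h0, mul_zero] at hz'
      rcases hF z 1 (by simp) with h | h
      · exact h hz'.symm
      · exact h h0
    refine ⟨z, ?_⟩
    rw [toMap_coe, homPt_of_ne hden, ← hz', mul_div_cancel_right₀ _ hden]

lemma Nondeg.exists_conj_infty (hF : F.Nondeg) {x : OnePoint ℂ} (hx : F.toMap x = x) :
    ∃ G : QuadPair, G.Nondeg ∧ G.d = 0 ∧
      ∃ φ : GL (Fin 2) ℂ, (∀ y, φ • F.toMap y = G.toMap (φ • y)) ∧ φ • x = ∞ := by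
  induction x using OnePoint.rec with
  | infty =>
    refine ⟨F, hF, ?_, 1, by simp, by simp⟩
    by_contra hd
    rw [toMap_infty, homPt_of_ne hd] at hx
    exact OnePoint.coe_ne_infty _ hx
  | coe z =>
    have hden : F.den z 1 ≠ 0 := by
      intro h0
      rw [toMap_coe, h0, homPt_zero_right] at hx
      exact OnePoint.infty_ne_coe _ hx
    have hz : F.num z 1 - z * F.den z 1 = 0 := by
      rw [toMap_coe, homPt_of_ne hden] at hx
      have := OnePoint.coe_injective hx
      rw [div_eq_iff hden] at this
      rw [this, sub_self]
    -- The conjugacy is `x ↦ 1 / (x - z)`. The last coefficient `num z 1 - z * den z 1` of the new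
    -- denominator vanishes because `z` is fixed.
    have hdet : (0 : ℂ) * -z - 1 * 1 ≠ 0 := by simp
    let G : QuadPair := ⟨F.den z 1, 2 * F.d * z + F.e, F.d, 0,
      2 * F.a * z + F.b - z * (2 * F.d * z + F.e), F.a - z * F.d⟩
    have h₁ : ∀ x y, 0 * F.num x y + 1 * F.den x y =
        1 * G.num (0 * x + 1 * y) (1 * x + -z * y) := by
      intro x y
      simp only [G, num, den]
      ring
    have h₂ : ∀ x y, 1 * F.num x y + -z * F.den x y =
        1 * G.den (0 * x + 1 * y) (1 * x + -z * y) := by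
      intro x y
      simp only [G, num, den] at hz ⊢
      linear_combination y ^ 2 * hz
    refine ⟨G, hF.of_conj hdet h₁ h₂, rfl, moebius hdet,
      hF.moebius_smul_toMap hdet one_ne_zero h₁ h₂, ?_⟩
    rw [← homPt_one_right, moebius_smul_homPt hdet (by simp)]
    simp [homPt]

lemma laurent_conj_scale {α β γ : ℂ} (hα : α ≠ 0) (hγ : γ ≠ 0) {t : ℂ} (ht : t ≠ 0) :
    AreMoebiusConjugate (laurent α β γ).toMap (laurent α (t * β) (t ^ 2 * γ)).toMap := by
  refine (laurent_nondeg hα hγ).areMoebiusConjugate t 0 0 1 (by simpa using ht) t⁻¹ (by simpa) ?_ ?_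
  · intro x y
    simp only [laurent, num, den]
    field_simp
    ring
  · intro x y
    simp only [laurent, num, den]
    field_simp
    ring

/-- A map with a fixed point is conjugate to a polynomial `z ^ 2 + c` or to a map
`w ↦ α w + β + γ / w`, with the fixed point sent to `∞`. -/
lemma Nondeg.exists_normalForm (hF : F.Nondeg) {x : OnePoint ℂ} {m : ℂ}
    (h : HasCycleMultiplier F.toMap 1 x m) :
    (m = 0 ∧ ∃ c, AreMoebiusConjugate F.toMap (poly c).toMap) ∨
      ∃ α β γ, m * α = 1 ∧ γ ≠ 0 ∧ AreMoebiusConjugate F.toMap (laurent α β γ).toMap := by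
  obtain ⟨G, hG, hd, φ, hφ, hx⟩ := hF.exists_conj_infty h.fixed
  have hFG : AreMoebiusConjugate F.toMap G.toMap := ⟨φ, hφ⟩
  have ha : G.a ≠ 0 := by
    rcases hG 1 0 (by simp) with h | h
    · simpa [num] using h
    · simp [den, hd] at h
  have hm : m = G.e / G.a := by
    have := (h.conj hφ).hasSphereDeriv
    rw [hx] at this
    exact this.unique (hasSphereDeriv_infty hd ha)
  -- If `e = 0`, the only pole is `∞`, and an affine change completing the square gives `z² + c`.
  -- Otherwise there is a finite pole `-f/e`, which `x ↦ e x + f` moves to 0.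
  by_cases he : G.e = 0
  · left
    refine ⟨by rw [hm, he, zero_div], ?_⟩
    have hf : G.f ≠ 0 := by
      intro hf
      obtain ⟨z, hz⟩ := exists_quadratic_root (G.b / G.a) (G.c / G.a)
      rcases hG z 1 (by simp) with h | h
      · apply h
        simp only [num]
        field_simp at hz
        linear_combination hz
      · simp [den, hd, he, hf] at h
    refine ⟨G.a * G.c / G.f ^ 2 + G.b / (2 * G.f) - G.b ^ 2 / (4 * G.f ^ 2), hFG.trans ?_⟩
    refine hG.areMoebiusConjugate (G.a / G.f) (G.b / (2 * G.f)) 0 1 (by simp [ha, hf]) G.f hf ?_ ?_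
    · intro x y
      simp only [num, den, poly, hd, he]
      field_simp
      ring
    · intro x y
      simp only [num, den, poly, hd, he]
      ring
  · right
    have hdet : G.e * 1 - G.f * 0 ≠ 0 := by simpa using he
    have h₁ : ∀ x y, G.e * G.num x y + G.f * G.den x y = 1 * (laurent (G.a / G.e)
        (G.b + G.f - 2 * G.a * G.f / G.e)
        (G.a * G.f ^ 2 / G.e - G.b * G.f + G.c * G.e)).num
          (G.e * x + G.f * y) (0 * x + 1 * y) := by
      intro x y
      simp only [num, den, laurent, hd]
      field_simp
      ring
    have h₂ : ∀ x y, 0 * G.num x y + 1 * G.den x y = 1 * (laurent (G.a / G.e)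
        (G.b + G.f - 2 * G.a * G.f / G.e)
        (G.a * G.f ^ 2 / G.e - G.b * G.f + G.c * G.e)).den
          (G.e * x + G.f * y) (0 * x + 1 * y) := by
      intro x y
      simp only [num, den, laurent, hd]
      ring
    refine ⟨_, _, _, ?_, ?_, hFG.trans
      (hG.areMoebiusConjugate _ _ _ _ hdet 1 one_ne_zero h₁ h₂)⟩
    · rw [hm]
      field_simp
    · rcases hG.of_conj hdet h₁ h₂ 0 1 (by simp) with h | h
      · simpa [num, laurent] using h
      · simp [den, laurent] at h

/-- The multiplier of `w ↦ α w + β + γ / w` at a finite fixed point. -/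
lemma laurent_fixed {α β γ w : ℂ} (hw : w ≠ 0) (h : α * w + β + γ / w = w) :
    HasCycleMultiplier (laurent α β γ).toMap 1 w (α - γ / w ^ 2) :=
  .of_isFixedPt (by rw [laurent_toMap_coe _ _ _ hw, h]) (laurent_hasSphereDeriv _ _ _ hw)

/-! ### The model maps as pairs of quadratic forms. -/

lemma ratMap_X_sq : ratMap (X ^ 2) 1 = (poly 0).toMap := by
  rw [ratMap_eq_toMap (by simp)]
  simp [poly, coeff_X_pow, coeff_one]

lemma ratMap_one_X_sq : ratMap 1 (X ^ 2) = toMap ⟨0, 0, 1, 1, 0, 0⟩ := by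
  rw [ratMap_eq_toMap (by simp)]
  simp [coeff_X_pow, coeff_one]

lemma ratMap_chebyshev : ratMap (Chebyshev.C ℂ (2 : ℕ)) 1 = (poly (-2)).toMap := by
  have hC : Chebyshev.C ℂ (2 : ℕ) = X ^ 2 - Polynomial.C 2 := by
    rw [Nat.cast_ofNat, Chebyshev.C_two, map_ofNat]
  rw [hC, ratMap_eq_toMap (by rw [natDegree_X_pow_sub_C]; simp)]
  simp [poly, coeff_X_pow, coeff_one, coeff_C]

/-! ### The case distinction on the fixed point multipliers -/

lemma conj_poly_of_multiplier_zero (hF : F.Nondeg) (hI : IntegerCycleMultipliers F.toMap)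
    {x : OnePoint ℂ} (hx : HasCycleMultiplier F.toMap 1 x 0) :
    AreMoebiusConjugate F.toMap (poly 0).toMap ∨ AreMoebiusConjugate F.toMap (poly (-2)).toMap := by
  rcases hF.exists_normalForm hx with ⟨-, c, hc⟩ | ⟨α, β, γ, h, -⟩
  swap
  · simp at h
  have hI' := hc.integerCycleMultipliers hI
  obtain ⟨z, hz⟩ := exists_quadratic_root (-1) c
  obtain ⟨k, hk⟩ := hI' 1 z (2 * z) (.of_isFixedPt
    (by rw [poly_toMap_coe]; congr 1; linear_combination hz) (poly_hasSphereDeriv c z))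
  -- A fixed point `z` of multiplier `k = 2z` has `c = z - z²`, so `n = 1 - k` is the integer
  -- required below.
  have h4 : 4 * c = 1 - ((1 - k : ℤ) : ℂ) ^ 2 := by
    push_cast
    rw [← hk]
    linear_combination 4 * hz
  rcases poly_sq_of_integerCycleMultipliers h4 hI' with h | h
  · have h' : ((1 - k : ℤ) : ℂ) ^ 2 = 1 := by exact_mod_cast h
    rw [h'] at h4
    left
    rwa [show c = 0 by linear_combination h4 / 4] at hc
  · have h' : ((1 - k : ℤ) : ℂ) ^ 2 = 9 := by exact_mod_cast h
    rw [h'] at h4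
    right
    rwa [show c = -2 by linear_combination h4 / 4] at hc

lemma multiplier_ne_one (hF : F.Nondeg) (hI : IntegerCycleMultipliers F.toMap) (x : OnePoint ℂ) :
    ¬ HasCycleMultiplier F.toMap 1 x 1 := by
  intro hx
  rcases hF.exists_normalForm hx with ⟨h, -⟩ | ⟨α, β, γ, h, hγ, hc⟩
  · exact one_ne_zero h
  rw [one_mul] at h
  subst h
  -- If `β = 0`, there is no finite fixed point, and scaling normalises `γ` to -1. Otherwise scaling
  -- normalises `β` to 1.
  by_cases hβ : β = 0
  · subst hβ
    obtain ⟨t, ht⟩ := IsAlgClosed.exists_pow_nat_eq (-γ⁻¹) (n := 2) (by norm_num)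
    have ht0 : t ≠ 0 := by
      rintro rfl
      simp [hγ] at ht
    have hc' := hc.trans (laurent_conj_scale one_ne_zero hγ ht0)
    rw [ht, mul_zero, neg_mul, inv_mul_cancel₀ hγ] at hc'
    exact not_integerCycleMultipliers_laurent_one_zero_neg_one (hc'.integerCycleMultipliers hI)
  · have hc' := hc.trans (laurent_conj_scale one_ne_zero hγ (inv_ne_zero hβ))
    rw [inv_mul_cancel₀ hβ] at hc'
    have hk0 : β⁻¹ ^ 2 * γ ≠ 0 := by simp [hβ, hγ]
    generalize β⁻¹ ^ 2 * γ = k at hc' hk0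
    have hI' := hc'.integerCycleMultipliers hI
    -- The finite fixed point is `-k`, with multiplier `1 - 1/k`; hence `1/k` is an integer.
    obtain ⟨n, hn⟩ := hI' _ _ _ (laurent_fixed (α := 1) (β := 1) (neg_ne_zero.2 hk0)
      (by field_simp; ring))
    have hka : k * ((1 - n : ℤ) : ℂ) = 1 := by
      push_cast
      rw [← hn]
      field_simp
      ring
    have ha : 1 - n ≠ 0 := by
      intro h0
      rw [h0] at hka
      simp at hka
    rcases laurent_eq_of_integerCycleMultipliers ha hka hI' with h | h | h <;> rw [h] at hka <;>
      push_cast at hka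
    · rw [show k = -1 by linear_combination -hka] at hI'
      exact not_integerCycleMultipliers_laurent_one_one_neg_one hI'
    · rw [show k = 1 / 3 by linear_combination hka / 3] at hI'
      exact not_integerCycleMultipliers_laurent_one_one_third hI'
    · rw [show k = 1 / 4 by linear_combination hka / 4] at hI'
      exact not_integerCycleMultipliers_laurent_one_one_fourth hI'

/-- If no fixed point has multiplier `0` or `1`, the map is determined by the three integers
`1 - μ`, for `μ` the multipliers at the fixed points, and the sum of their inverses is `1`. -/
lemma exists_three_multipliers (hF : F.Nondeg) (hI : IntegerCycleMultipliers F.toMap)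
    (h0 : ∀ x, ¬ HasCycleMultiplier F.toMap 1 x 0) {x : OnePoint ℂ} {μ : ℤ}
    (hx : HasCycleMultiplier F.toMap 1 x μ) :
    ∃ B C : ℤ, (∃ y, HasCycleMultiplier F.toMap 1 y ((1 - B : ℤ) : ℂ)) ∧
      (∃ y, HasCycleMultiplier F.toMap 1 y ((1 - C : ℤ) : ℂ)) ∧
      B * C + (1 - μ) * C + (1 - μ) * B = (1 - μ) * B * C ∧
      ∃ α r : ℂ, μ * α = 1 ∧ B = (1 - α) * (1 - r) ∧
        AreMoebiusConjugate F.toMap (laurent α ((1 - α) * (1 + r)) (-(1 - α) * r)).toMap := by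
  rcases hF.exists_normalForm hx with ⟨h, -⟩ | ⟨α, β, γ, hα, hγ, hc⟩
  · exact absurd (h ▸ hx) (h0 x)
  have hα0 : α ≠ 0 := right_ne_zero_of_mul_eq_one hα
  have hα1 : 1 - α ≠ 0 := by
    intro h1
    have h1 : α = 1 := by linear_combination -h1
    rw [h1, mul_one] at hα
    rw [hα] at hx
    exact multiplier_ne_one hF hI x hx
  -- `v` and `w` are the finite fixed points, the roots of `(1 - α) X² - β X - γ`.
  obtain ⟨v, hv⟩ := exists_quadratic_root (-β / (1 - α)) (-γ / (1 - α))
  obtain ⟨w, hw⟩ : ∃ w, w = β / (1 - α) - v := ⟨_, rfl⟩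
  have hsum : β = (1 - α) * (v + w) := by
    rw [hw]; field_simp; ring
  have hprod : γ = -(1 - α) * (v * w) := by
    rw [hw]
    field_simp at hv ⊢
    linear_combination -hv
  have hv0 : v ≠ 0 := by
    rintro rfl
    simp [hprod] at hγ
  have hw0 : w ≠ 0 := by
    rintro rfl
    simp [hprod] at hγ
  have hfv := laurent_fixed (α := α) (β := β) (γ := γ) hv0 (by
    rw [hsum, hprod]; field_simp; ring)
  have hfw := laurent_fixed (α := α) (β := β) (γ := γ) hw0 (by
    rw [hsum, hprod]; field_simp; ring)
  have hI' := hc.integerCycleMultipliers hI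
  obtain ⟨b, hb⟩ := hI' _ _ _ hfv
  obtain ⟨c, hcc⟩ := hI' _ _ _ hfw
  have hB : ((1 - b : ℤ) : ℂ) = (1 - α) * (1 - w / v) := by
    push_cast
    rw [← hb, hprod]; field_simp; ring
  have hC : ((1 - c : ℤ) : ℂ) = (1 - α) * (1 - v / w) := by
    push_cast
    rw [← hcc, hprod]; field_simp; ring
  refine ⟨1 - b, 1 - c, ?_, ?_, ?_, α, w / v, hα, hB, ?_⟩
  · rw [sub_sub_cancel, ← hb]
    exact hc.symm.exists_hasCycleMultiplier hfv
  · rw [sub_sub_cancel, ← hcc]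
    exact hc.symm.exists_hasCycleMultiplier hfw
  · have hμ : (μ : ℂ) = 1 / α := by field_simp; exact hα
    have : (((1 - b) * (1 - c) + (1 - μ) * (1 - c) + (1 - μ) * (1 - b) : ℤ) : ℂ) =
        ((1 - μ) * (1 - b) * (1 - c) : ℤ) := by
      rw [Int.cast_add, Int.cast_add, Int.cast_mul, Int.cast_mul, Int.cast_mul, Int.cast_mul,
        Int.cast_mul, hB, hC]
      push_cast
      rw [hμ]
      field_simp
      ring
    exact_mod_cast this
  -- Scaling by `1/v` puts the finite fixed points at 1 and `r = w/v`.
  · have := hc.trans (laurent_conj_scale hα0 hγ (inv_ne_zero hv0))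
    rwa [show v⁻¹ * β = (1 - α) * (1 + w / v) by rw [hsum]; field_simp,
      show v⁻¹ ^ 2 * γ = -(1 - α) * (w / v) by rw [hprod]; field_simp] at this

/-- The equation `1/2 + 1/B + 1/C = 1` reads `(B - 2)(C - 2) = 4`. The solution `B = -2` is excluded
by `C ≠ 1`. -/
lemma eq_of_sum_inv_eq_one_of_two {B C : ℤ} (hB0 : B ≠ 0) (hB1 : B ≠ 1) (hC1 : C ≠ 1)
    (h : B * C + 2 * C + 2 * B = 2 * B * C) : B = 3 ∨ B = 4 ∨ B = 6 := by
  have hprod : (B - 2) * (C - 2) = 4 := by linear_combination -h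
  have hdvd : (B - 2) ∣ 4 := ⟨_, hprod.symm⟩
  have hle := Int.le_of_dvd (by norm_num) hdvd
  have hge := Int.le_of_dvd (by norm_num) ((neg_dvd).2 hdvd)
  have h1 : B ≤ 6 := by linarith
  have h2 : -2 ≤ B := by linarith
  clear hdvd hle hge hprod
  interval_cases B <;> omega

lemma inv_le_third {A : ℤ} (h0 : A ≠ 0) (h1 : A ≠ 1) (h2 : A ≠ 2) : (A : ℚ)⁻¹ ≤ 3⁻¹ := by
  rcases lt_or_ge A 0 with h | h
  · have : (A : ℚ) < 0 := by exact_mod_cast h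
    exact (inv_lt_zero.2 this).le.trans (by norm_num)
  · have : (3 : ℚ) ≤ A := by exact_mod_cast (show (3 : ℤ) ≤ A by omega)
    gcongr

/-- Each reciprocal is at most 1/3, so a sum equal to 1 forces equality throughout. -/
lemma eq_three_of_sum_inv_eq_one {A B C : ℤ} (hA0 : A ≠ 0) (hA1 : A ≠ 1) (hA2 : A ≠ 2)
    (hB0 : B ≠ 0) (hB1 : B ≠ 1) (hB2 : B ≠ 2) (hC0 : C ≠ 0) (hC1 : C ≠ 1) (hC2 : C ≠ 2)
    (h : B * C + A * C + A * B = A * B * C) : A = 3 ∧ B = 3 := by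
  have hA := inv_le_third hA0 hA1 hA2
  have hB := inv_le_third hB0 hB1 hB2
  have hC := inv_le_third hC0 hC1 hC2
  have hsum : (A : ℚ)⁻¹ + (B : ℚ)⁻¹ + (C : ℚ)⁻¹ = 1 := by
    have h' : (B : ℚ) * C + A * C + A * B = A * B * C := by exact_mod_cast h
    have : (A : ℚ) ≠ 0 := by exact_mod_cast hA0
    have : (B : ℚ) ≠ 0 := by exact_mod_cast hB0
    have : (C : ℚ) ≠ 0 := by exact_mod_cast hC0
    field_simp
    linear_combination h'
  have h1 : (A : ℚ)⁻¹ = 3⁻¹ := by linarith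
  have h2 : (B : ℚ)⁻¹ = 3⁻¹ := by linarith
  rw [inv_inj] at h1 h2
  exact ⟨by exact_mod_cast h1, by exact_mod_cast h2⟩

lemma multiplier_ne_neg_one (hF : F.Nondeg) (hI : IntegerCycleMultipliers F.toMap)
    (h0 : ∀ x, ¬ HasCycleMultiplier F.toMap 1 x 0) (x : OnePoint ℂ) :
    ¬ HasCycleMultiplier F.toMap 1 x (-1) := by
  intro hx
  have h1 := multiplier_ne_one hF hI
  obtain ⟨B, C, ⟨y, hy⟩, ⟨z, hz⟩, hBC, α, r, hα, hr, hc⟩ :=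
    exists_three_multipliers hF hI h0 (μ := -1) (by simpa using hx)
  have hα' : α = -1 := by push_cast at hα; linear_combination -hα
  subst hα'
  have hB : B = 3 ∨ B = 4 ∨ B = 6 := by
    refine eq_of_sum_inv_eq_one_of_two (C := C) ?_ ?_ ?_ (by linear_combination hBC)
    · rintro rfl; exact h1 y (by simpa using hy)
    · rintro rfl; exact h0 y (by simpa using hy)
    · rintro rfl; exact h0 z (by simpa using hz)
  -- `B = 3` and `B = 6` both belong to the triple `{2, 3, 6}`; they differ in which finite fixed
  -- point sits at 1, and scaling by -2 identifies them.
  rcases hB with rfl | rfl | rfl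
  · rw [show r = -1 / 2 by push_cast at hr; linear_combination hr / 2] at hc
    have hc' := hc.trans (laurent_conj_scale (by norm_num) (by norm_num) (t := -2) (by norm_num))
    norm_num at hc'
    exact not_integerCycleMultipliers_laurent_neg_one_neg_two_four (hc'.integerCycleMultipliers hI)
  · rw [show r = -1 by push_cast at hr; linear_combination hr / 2] at hc
    norm_num at hc
    exact not_integerCycleMultipliers_laurent_neg_one_zero_two (hc.integerCycleMultipliers hI)
  · rw [show r = -2 by push_cast at hr; linear_combination hr / 2] at hc
    norm_num at hc
    exact not_integerCycleMultipliers_laurent_neg_one_neg_two_four (hc.integerCycleMultipliers hI)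

/-- The critical points `±s`, with `s² = -3`, are exchanged by the map. The conjugacy `w ↦ (w - s) /
(w + s)` sends them to 0 and `∞`, and the fixed points `∞, 1, -1` to the cube roots of unity. -/
lemma laurent_conj_inv_sq :
    AreMoebiusConjugate (laurent (-1 / 2) 0 (3 / 2)).toMap (toMap ⟨0, 0, 1, 1, 0, 0⟩) := by
  obtain ⟨s, hs⟩ := exists_quadratic_root 0 3
  have hs0 : s ≠ 0 := by
    rintro rfl
    norm_num at hs
  refine (laurent_nondeg (by norm_num) (by norm_num)).areMoebiusConjugate 1 (-s) 1 s
    (fun h => hs0 (by linear_combination h / 2)) (-1 / 2) (by norm_num) ?_ ?_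
  · intro x y
    simp only [laurent, num, den]
    linear_combination y ^ 2 / 2 * hs
  · intro x y
    simp only [laurent, num, den]
    linear_combination y ^ 2 / 2 * hs

lemma conj_inv_sq (hF : F.Nondeg) (hI : IntegerCycleMultipliers F.toMap)
    (h0 : ∀ x, ¬ HasCycleMultiplier F.toMap 1 x 0) :
    AreMoebiusConjugate F.toMap (toMap ⟨0, 0, 1, 1, 0, 0⟩) := by
  have h1 := multiplier_ne_one hF hI
  have h2 := multiplier_ne_neg_one hF hI h0
  have hne : ∀ {n : ℤ} {y : OnePoint ℂ}, HasCycleMultiplier F.toMap 1 y ((1 - n : ℤ) : ℂ) →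
      n ≠ 0 ∧ n ≠ 1 ∧ n ≠ 2 := by
    intro n y hy
    refine ⟨?_, ?_, ?_⟩ <;> rintro rfl
    · exact h1 y (by simpa using hy)
    · exact h0 y (by simpa using hy)
    · exact h2 y (by norm_num at hy; exact hy)
  obtain ⟨x, hx⟩ := hF.exists_fixed
  -- The derivative at `x` is obtained by moving `x` to `∞`, where it is explicit, and conjugating
  -- back.
  obtain ⟨m, hm⟩ : ∃ m, HasSphereDeriv F.toMap x m := by
    obtain ⟨G, hG, hd, φ, hφ, hφx⟩ := hF.exists_conj_infty hx
    have ha : G.a ≠ 0 := by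
      rcases hG 1 0 (by simp) with h | h
      · simpa [num] using h
      · simp [den, hd] at h
    have hcyc : HasCycleMultiplier G.toMap 1 ∞ (G.e / G.a) :=
      .of_isFixedPt (by rw [toMap_infty, hd, homPt_zero_right]) (hasSphereDeriv_infty hd ha)
    have := hcyc.conj (φ := φ⁻¹) (g := F.toMap) (fun y => by
      rw [inv_smul_eq_iff, hφ, smul_inv_smul])
    rw [← hφx, inv_smul_smul] at this
    exact ⟨_, this.hasSphereDeriv⟩
  have hcyc := HasCycleMultiplier.of_isFixedPt hx hm
  obtain ⟨μ, rfl⟩ := hI _ _ _ hcyc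
  obtain ⟨B, C, ⟨y, hy⟩, ⟨z, hz⟩, hBC, α, r, hα, hr, hc⟩ :=
    exists_three_multipliers hF hI h0 hcyc
  obtain ⟨hA0, hA1, hA2⟩ := hne (n := 1 - μ) (by rwa [sub_sub_cancel])
  obtain ⟨hB0, hB1, hB2⟩ := hne hy
  obtain ⟨hC0, hC1, hC2⟩ := hne hz
  obtain ⟨hA, rfl⟩ := eq_three_of_sum_inv_eq_one hA0 hA1 hA2 hB0 hB1 hB2 hC0 hC1 hC2 hBC
  obtain rfl : μ = -2 := by linarith
  have hα' : α = -1 / 2 := by push_cast at hα; linear_combination -hα / 2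
  subst hα'
  rw [show r = -1 by push_cast at hr; linear_combination 2 / 3 * hr] at hc
  norm_num at hc
  refine hc.trans ?_
  have := laurent_conj_inv_sq
  norm_num at this
  exact this

end QuadPair

theorem mainTheorem2 (f : OnePoint ℂ → OnePoint ℂ) (hf : IsRationalMap 2 f)
    (hmult : HasOnlyIntegerMultipliers f) : IsPowerMap f ∨ IsChebyshevMap f := by
  obtain ⟨F, hF, rfl⟩ : ∃ F : QuadPair, F.Nondeg ∧ f = F.toMap := by
    obtain ⟨p, q, hpq, hdeg, rfl⟩ := hf
    exact ⟨_, nondeg_of_isCoprime hpq hdeg, ratMap_eq_toMap hdeg⟩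
  have hI : IntegerCycleMultipliers F.toMap := fun n x m h => h.exists_int hmult
  by_cases h0 : ∃ x, HasCycleMultiplier F.toMap 1 x 0
  · obtain ⟨x, hx⟩ := h0
    rcases conj_poly_of_multiplier_zero hF hI hx with h | h
    · exact .inl ⟨2, le_rfl, hf, .inl (by rwa [ratMap_X_sq])⟩
    · exact .inr ⟨2, le_rfl, hf, .inl (by rwa [ratMap_chebyshev])⟩
  · push Not at h0
    exact .inl ⟨2, le_rfl, hf, .inr (by
      rw [ratMap_one_X_sq]
      exact conj_inv_sq hF hI h0)⟩
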